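/- **Model.** A linear array has $N$ elements with spacing $d>0$, at positions $\mathbf n\,d$ with $\mathbf n=[-\tfrac{N-1}{2},\dots,\tfrac{N-1}{2}]^T$, and carrier frequencies $f_c+m_k\Delta f$ with $\mathbf m=[m_0,\dots,m_{N-1}]^T\in\mathbb R^N$; here $f_c,\Delta f,c>0$, where $c$ is the propagation speed. For direction $\theta$ and range $r$ the steering vector is $$b_k(\theta,r)=e^{-j\frac{4\pi}{c}\left[f_c r+n_kf_cd\sin\theta+m_k\Delta f\,r\right]} .$$ There are $P$ targets at $(\theta_i,r_i)$ with $\cos\theta_i\ne0$. The observations are $L$ snapshots $$\mathbf r(l)=\sum_{i=1}^P\alpha_i(l)\,\mathbf b(\theta_i,r_i)+\mathbf v(l),$$ where $\mathbf v(l)$ is circular complex white Gaussian noise with known power $\sigma_n^2>0$ and the complex amplitudes $\alpha_i(l)$ are unknown deterministic nuisance parameters. Let $\mathbf J_\xi$ be the Fisher information matrix of $\xi=(\theta_1,r_1,\dots,\theta_P,r_P)$ in the presence of these nuisance parameters, that is, the Schur complement of the amplitude block in the Fisher information matrix of all real parameters. Put - $\mathbf A=[\mathbf b(\theta_1,r_1),\dots,\mathbf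 b(\theta_P,r_P)]$ and $\mathbf P_A^\perp=\mathbf I-\mathbf A(\mathbf A^H\mathbf A)^{-1}\mathbf A^H$; - $\mathbf D=\big[\partial_\theta\mathbf b(\theta_1,r_1),\partial_r\mathbf b(\theta_1,r_1),\dots,\partial_\theta\mathbf b(\theta_P,r_P),\partial_r\mathbf b(\theta_P,r_P)\big]$; - $S_{ij}=\frac1L\sum_l\alpha_i(l)\alpha_j(l)^*$; - $\mathbf M_i=\mathbf m\odot\mathbf b(\theta_i,r_i)$, $\mathbf N_i=\mathbf n\odot\mathbf b(\theta_i,r_i)$; - $\gamma_i=|\mathbf P_A^\perp\mathbf M_i|^2\,|\mathbf P_A^\perp\mathbf N_i|^2-\tfrac12\big|\mathbf M_i^H\mathbf P_A^\perp\mathbf N_i\big|^2-\tfrac12\Re\big\{[\mathbf M_i^H\mathbf P_A^\perp\mathbf N_i]^2\big\}$. The Cramér–Rao bound (CRB) of the $q$-th entry of $\xi$ is $\sup_u u_q^2/(u^T\mathbf J_\xi u)\in[0,\infty]$ (with $0/0=0$ and $x/0=\infty$ for $x>0$). It equals $[\mathbf J_\xi^{-1}]_{qq}$ when $\mathbf J_\xi$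 is positive definite. **Claims.** In 1–4 the columns of $\mathbf A$ are assumed linearly independent. 1. *Fisher information.* For all amplitudes, $\mathbf J_\xi=\frac{2L}{\sigma_n^2}\Re\big\{(\mathbf D^H\mathbf P_A^\perp\mathbf D)\odot\big(\mathbf S^T\otimes\big[\begin{smallmatrix}1&1\\1&1\end{smallmatrix}\big]\big)\big\}$. 2. *The coefficient $\gamma$.* $\gamma_i\ge0$, and $\gamma_i=0$ if and only if $\mathbf P_A^\perp\mathbf M_i$ and $\mathbf P_A^\perp\mathbf N_i$ are linearly dependent over $\mathbb R$. If $\mathbf m=a\mathbf n+e\mathbf 1$ with $a,e\in\mathbb R$ (frequencies linear along the array, in particular $\mathbf m=\mathbf n$), then $\gamma_i=0$ for every $i$. For a single target ($P=1$), $\gamma_1=0$ if and only if $\mathbf m=a\mathbf n+e\mathbf 1$ for some $a,e\in\mathbb R$. 3. *Uncorrelated amplitudes.* Suppose $S_{ij}=0$ for $i\ne j$ and $S_{ii}\neq0$ for all $i$. - $\mathbf J_\xi$ is block diagonal with one $2\times2$ block per target. It is invertible if and only if all $\gamma_i>0$; then $\mathbf J_\xi^{-1}$ is the block diagonal matrix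 of the inverses of the blocks, and the CRBs are its diagonal entries. - If $\gamma_i>0$, then $$\mathrm{CRB}_{\theta_i}=\frac{\sigma_n^2c^2}{2LS_{ii}(4\pi f_cd\cos\theta_i)^2\gamma_i}\,|\mathbf P_A^\perp\mathbf M_i|^2,\qquad \mathrm{CRB}_{r_i}=\frac{\sigma_n^2c^2}{2LS_{ii}(4\pi\Delta f)^2\gamma_i}\,|\mathbf P_A^\perp\mathbf N_i|^2 .$$ - $\gamma_i=0$ if and only if $\mathrm{CRB}_{\theta_i}=\infty$ or $\mathrm{CRB}_{r_i}=\infty$. If $\gamma_i=0$, then $\mathbf P_A^\perp\mathbf M_i\ne0$ implies $\mathrm{CRB}_{\theta_i}=\infty$, and $\mathbf P_A^\perp\mathbf N_i\neq0$ implies $\mathrm{CRB}_{r_i}=\infty$. - If $\mathbf m=\mathbf n$ (linear FDA), or more generally $\mathbf m=a\mathbf n+e\mathbf 1$ with $a\ne0$, then $\gamma_i=0$ and $\mathrm{CRB}_{\theta_i}=\mathrm{CRB}_{r_i}=\infty$ for every $i$. 4. *Amplitudes uncorrelated in the limit.* Suppose that the snapshots come from a sequence $(\alpha_i(l))_{l\ge0}$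 for which, as $L\to\infty$, $S_{ij}\to0$ for $i\neq j$ and $S_{ii}\to s_i>0$. Then the off-diagonal blocks of $\frac1L\mathbf J_\xi$ tend to $0$. If moreover all $\gamma_i>0$, then $L\cdot\mathrm{CRB}_{\theta_i}$ and $L\cdot\mathrm{CRB}_{r_i}$ converge to $L$ times the expressions in 3 with $S_{ii}$ replaced by $s_i$. 5. *Random frequencies.* Let $m_0,\dots,m_{N-1}$ be i.i.d. with a law without atoms (e.g. Gaussian or continuous uniform), let $N\ge P+2$, and suppose that for $i\neq j$ with $r_i=r_j$ the number $2f_cd(\sin\theta_i-\sin\theta_j)/c$ is not an integer. Then almost surely the columns of $\mathbf A$ are linearly independent, $\gamma_i>0$ for all $i$, and, for all amplitudes as in 3, all CRBs are finite. -/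

import Mathlib

open scoped ENNReal Matrix Kronecker Topology

noncomputable section

/-- Physical constants of the array and of the receiver: centre frequency `fc`, element spacing
`d`, frequency increment `Δf`, propagation speed `c`, and noise power `σ ^ 2` per complex sample. -/
structure FDA where
  fc : ℝ
  d : ℝ
  Δf : ℝ
  c : ℝ
  σ : ℝ
  fc_pos : 0 < fc
  d_pos : 0 < d
  Δf_pos : 0 < Δf
  c_pos : 0 < c
  σ_pos : 0 < σ

namespace FDA

/-- The symmetric element positions `n = [-(N-1)/2, …, (N-1)/2]`, in units of the spacing. -/
def pos (N : ℕ) (k : Fin N) : ℝ := (k : ℝ) - ((N : ℝ) - 1) / 2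

variable (R : FDA) {N P L : ℕ}

/-- Direction steering vector `b_D(θ)`. -/
def bD (N : ℕ) (θ : ℝ) (k : Fin N) : ℂ :=
  Complex.exp (-Complex.I * ((4 * Real.pi * R.fc * R.d * Real.sin θ / R.c * pos N k : ℝ) : ℂ))

/-- Range steering vector `b_R(r)` for the frequency code `m`
(the `k`-th carrier frequency is `fc + m k * Δf`). -/
def bR (m : Fin N → ℝ) (r : ℝ) (k : Fin N) : ℂ :=
  Complex.exp (-Complex.I * ((4 * Real.pi / R.c * R.fc * r : ℝ) : ℂ)) *
    Complex.exp (-Complex.I * ((4 * Real.pi * R.Δf / R.c * m k * r : ℝ) : ℂ))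

/-- Steering vector `b(θ, r) = b_D(θ) ⊙ b_R(r)`. -/
def steer (m : Fin N → ℝ) (θ r : ℝ) (k : Fin N) : ℂ := R.bD N θ k * R.bR m r k

/-! ### The statistical model -/

/-- Indices of the location parameters: `(i, 0)` is `θ i` and `(i, 1)` is `r i`. -/
abbrev LocIdx (P : ℕ) : Type := Fin P × Fin 2

/-- Indices of the nuisance parameters: `(l, i, 0)` and `(l, i, 1)` are the real and the imaginary
part of the amplitude of target `i` in snapshot `l`. -/
abbrev AmpIdx (P L : ℕ) : Type := Fin L × Fin P × Fin 2

/-- The full real parameter vector: locations and amplitudes. -/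
abbrev ParamIdx (P L : ℕ) : Type := LocIdx P ⊕ AmpIdx P L

/-- The parameter vector with given directions, ranges and amplitudes. -/
def param (θ r : Fin P → ℝ) (α : Fin L → Fin P → ℂ) : ParamIdx P L → ℝ :=
  Sum.elim (fun q => ![θ q.1, r q.1] q.2)
    (fun q => ![(α q.1 q.2.1).re, (α q.1 q.2.1).im] q.2.2)

/-- Noise-free echoes `∑ i, α_i(l) b(θ_i, r_i)` as a function of the full parameter vector. -/
def meanEcho (m : Fin N → ℝ) (η : ParamIdx P L → ℝ) (l : Fin L) (k : Fin N) : ℂ :=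
  ∑ i : Fin P, ((η (Sum.inr (l, i, 0)) : ℂ) + Complex.I * (η (Sum.inr (l, i, 1)) : ℂ)) *
    R.steer m (η (Sum.inl (i, 0))) (η (Sum.inl (i, 1))) k

/-- Density, with respect to Lebesgue measure, of `L` snapshots of the echoes in circular complex
white Gaussian noise of power `σ ^ 2`. -/
def density (m : Fin N → ℝ) (η : ParamIdx P L → ℝ) (y : Fin L → Fin N → ℂ) : ℝ :=
  ((Real.pi * R.σ ^ 2) ^ (N * L))⁻¹ *
    Real.exp (-(1 / R.σ ^ 2) * ∑ l, ∑ k, ‖y l k - R.meanEcho m η l k‖ ^ 2)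

end FDA

/-- Partial derivative of the log-likelihood with respect to the parameter `a`. -/
def score {ι Ω : Type*} [DecidableEq ι] (p : (ι → ℝ) → Ω → ℝ) (η : ι → ℝ) (a : ι) (y : Ω) : ℝ :=
  lineDeriv ℝ (fun η' => Real.log (p η' y)) η (Pi.single a 1)

/-- Fisher information matrix of a parametric family of densities:
the second moment matrix of the score. -/
def fisherInformation {ι Ω : Type*} [DecidableEq ι] [MeasureTheory.MeasureSpace Ω]
    (p : (ι → ℝ) → Ω → ℝ) (η : ι → ℝ) : Matrix ι ι ℝ :=
  Matrix.of fun a b => ∫ y, score p η a y * score p η b y * p η y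

/-- Fisher information matrix of the first group of parameters when the second group is an unknown
nuisance parameter: the Schur complement of the full Fisher information matrix. Its inverse is the
corresponding block of the inverse of the full matrix. -/
def efficientInformation {ι κ : Type*} [Fintype κ] [DecidableEq κ]
    (F : Matrix (ι ⊕ κ) (ι ⊕ κ) ℝ) : Matrix ι ι ℝ :=
  F.toBlocks₁₁ - F.toBlocks₁₂ * (F.toBlocks₂₂)⁻¹ * F.toBlocks₂₁

/-- Cramér–Rao bound for the `k`-th parameter under the information matrix `J`, as an extended
nonnegative number. This is the largest of the bounds `u_k ^ 2 / (uᵀ J u)` over all directions `u`;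
it is the diagonal entry `(J⁻¹) k k` if `J` is positive definite, and it is `∞` if the `k`-th
coordinate vector is not in the range of the positive semidefinite matrix `J`. -/
def crb {ι : Type*} [Fintype ι] (J : Matrix ι ι ℝ) (k : ι) : ℝ≥0∞ :=
  ⨆ u : ι → ℝ, ENNReal.ofReal (u k ^ 2) / ENNReal.ofReal (u ⬝ᵥ (J *ᵥ u))

namespace FDA

variable (R : FDA) {N P L : ℕ}

/-- Fisher information matrix `J_ξ` of `ξ = (θ_1, r_1, …, θ_P, r_P)`; the complex amplitudes are
unknown deterministic nuisance parameters. -/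
def fimLoc (m : Fin N → ℝ) (θ r : Fin P → ℝ) (α : Fin L → Fin P → ℂ) :
    Matrix (LocIdx P) (LocIdx P) ℝ :=
  efficientInformation (fisherInformation (R.density m) (param θ r α))

/-! ### The explicit quantities -/

/-- `A = [b(θ_1, r_1), …, b(θ_P, r_P)]`. -/
def matA (m : Fin N → ℝ) (θ r : Fin P → ℝ) : Matrix (Fin N) (Fin P) ℂ :=
  Matrix.of fun k i => R.steer m (θ i) (r i) k

/-- `P_A^⊥ = I - A (Aᴴ A)⁻¹ Aᴴ`. -/
def projPerp (m : Fin N → ℝ) (θ r : Fin P → ℝ) : Matrix (Fin N) (Fin N) ℂ :=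
  1 - R.matA m θ r * ((R.matA m θ r)ᴴ * R.matA m θ r)⁻¹ * (R.matA m θ r)ᴴ

/-- `D`: partial derivatives of the steering vectors by direction and range. -/
def matD (m : Fin N → ℝ) (θ r : Fin P → ℝ) : Matrix (Fin N) (LocIdx P) ℂ :=
  Matrix.of fun k q => ![deriv (fun t => R.steer m t (r q.1) k) (θ q.1),
    deriv (fun t => R.steer m (θ q.1) t k) (r q.1)] q.2

/-- `C = Dᴴ P_A^⊥ D`. -/
def matC (m : Fin N → ℝ) (θ r : Fin P → ℝ) : Matrix (LocIdx P) (LocIdx P) ℂ :=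
  (R.matD m θ r)ᴴ * R.projPerp m θ r * R.matD m θ r

/-- Sample covariance `S i j = (1 / L) ∑ l, α_i(l) α_j(l)^*` of the amplitudes. -/
def sampleCov (α : Fin L → Fin P → ℂ) : Matrix (Fin P) (Fin P) ℂ :=
  Matrix.of fun i j => (1 / (L : ℂ)) * ∑ l, α l i * star (α l j)

/-- `w ⊙ b(θ_i, r_i)` for a real vector `w`. -/
def weighted (m : Fin N → ℝ) (θ r : Fin P → ℝ) (w : Fin N → ℝ) (i : Fin P) : Fin N → ℂ :=
  fun k => (w k : ℂ) * R.steer m (θ i) (r i) k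

/-- `P_A^⊥ (w ⊙ b(θ_i, r_i))`. -/
def projected (m : Fin N → ℝ) (θ r : Fin P → ℝ) (w : Fin N → ℝ) (i : Fin P) : Fin N → ℂ :=
  R.projPerp m θ r *ᵥ R.weighted m θ r w i

/-- Squared Euclidean norm of a complex vector. -/
def sqNorm (v : Fin N → ℂ) : ℝ := ∑ k, ‖v k‖ ^ 2

/-- `(m ⊙ b(θ_i, r_i))ᴴ P_A^⊥ (n ⊙ b(θ_i, r_i))`. -/
def cross (m : Fin N → ℝ) (θ r : Fin P → ℝ) (i : Fin P) : ℂ :=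
  star (R.weighted m θ r m i) ⬝ᵥ (R.projPerp m θ r *ᵥ R.weighted m θ r (pos N) i)

/-- The coefficient `γ` of target `i`. -/
def gam (m : Fin N → ℝ) (θ r : Fin P → ℝ) (i : Fin P) : ℝ :=
  sqNorm (R.projected m θ r m i) * sqNorm (R.projected m θ r (pos N) i)
    - 1 / 2 * ‖R.cross m θ r i‖ ^ 2 - 1 / 2 * (R.cross m θ r i ^ 2).re

/-- The `2 × 2` diagonal block of a matrix that belongs to target `i`. -/
def block (J : Matrix (LocIdx P) (LocIdx P) ℝ) (i : Fin P) : Matrix (Fin 2) (Fin 2) ℝ :=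
  J.submatrix (fun a => (i, a)) (fun a => (i, a))

end FDA

end

/-! The log-likelihood is quadratic in the residual, so the score is a real-linear functional of the
Gaussian noise, and the full Fisher matrix is `2 / σ ^ 2` times the real Gram matrix of the
derivatives of the echoes (`fisherInformation_density`). The Schur complement of a Gram matrix is
the Gram matrix of the vectors projected off the nuisance directions. In each snapshot the amplitude
derivatives span, over the reals, the complex column space of `A`, so this projection is `P_A^⊥`
snapshot by snapshot (`fimLoc_apply`). Summing over snapshots produces the sample covariance.

Up to the common factor `-I`, the projected derivatives of a steering vector are real multiples of
the projected `n ⊙ b` and `m ⊙ b`; the carrier term of the range derivative lies in the column space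
of `A` and disappears. Since `|z|² / 2 + Re (z²) / 2 = (Re z)²`, the coefficient `γ` is the real
Gram determinant of these two vectors (`gam_eq`), and its sign and zeros are Cauchy–Schwarz with its
equality case.

For uncorrelated amplitudes each 2 × 2 block has determinant a positive multiple of `γ`. The bounds
come from Cauchy–Schwarz for the form `J`, which only requires the coordinate vector to lie in the
range of `J` (`crb_eq_of_mulVec_eq_single`); a degenerate target therefore does not affect the
others. A real relation between the projected vectors gives a null vector of `J`, hence infinite
bounds. The limit in `L` is continuity of matrix inversion.

For random codes, adjoining `m ⊙ b` and `n ⊙ b` to the columns of `A` gives a matrix whose full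
column rank implies everything wanted. Its Gram determinant is real analytic in `m`, so it is almost
surely nonzero once it is nonzero somewhere (`AnalyticOnNhd.ae_pi_ne_zero`). A suitable code is a
linear one perturbed at the last element, where a confluent Vandermonde system decides
(`exists_augmented_injective`). -/

noncomputable section
open MeasureTheory

/-! ### Second moments under product densities -/

/-- `φ` is a probability density, `a` and `b` are centred under `φ`, and their covariance
under `φ` is `c`. -/
structure HasCentredCov {X : Type*} [MeasureSpace X] (φ a b : X → ℝ) (c : ℝ) : Prop where
  integrable : Integrable φ
  integral_eq_one : ∫ x, φ x = 1
  integrable_left : Integrable fun x => a x * φ x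
  mean_left : ∫ x, a x * φ x = 0
  integrable_right : Integrable fun x => b x * φ x
  mean_right : ∫ x, b x * φ x = 0
  integrable_mul : Integrable fun x => a x * b x * φ x
  cov : ∫ x, a x * b x * φ x = c

/-- Integrals of products factor over the coordinates, and a cross term with `i ≠ j` contains a
centred factor, so covariances add. This is applied over real and imaginary parts, over array
elements and over snapshots. -/
theorem HasCentredCov.pi {ι X : Type*} [Fintype ι] [MeasureSpace X]
    [SigmaFinite (volume : Measure X)] {φ : X → ℝ} {a b : ι → X → ℝ} {c : ι → ℝ}
    (hφ : Integrable φ) (hφ1 : ∫ x, φ x = 1)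
    (h : ∀ i, HasCentredCov φ (a i) (b i) (c i)) :
    HasCentredCov (fun x : ι → X => ∏ i, φ (x i)) (fun x => ∑ i, a i (x i))
      (fun x => ∑ i, b i (x i)) (∑ i, c i) := by
  classical
  have key1 : ∀ f : X → ℝ, Integrable (fun x => f x * φ x) → ∫ x, f x * φ x = 0 → ∀ i,
      Integrable (fun x : ι → X => f (x i) * ∏ k, φ (x k)) ∧
        ∫ x : ι → X, f (x i) * ∏ k, φ (x k) = 0 := by
    intro f hf hf0 i
    -- Padding with the constant 1 in the other coordinates puts the integrand in pure product form.
    have e : (fun x : ι → X => f (x i) * ∏ k, φ (x k)) =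
        fun x => ∏ k, (fun k y => (if k = i then f y else 1) * φ y) k (x k) := by
      funext x
      simp only [Finset.prod_mul_distrib, Finset.prod_ite_eq', Finset.mem_univ, if_true]
    rw [e]
    refine ⟨Integrable.fintype_prod (μ := fun _ => volume)
      (f := fun k y => (if k = i then f y else 1) * φ y) fun k => ?_, ?_⟩
    · by_cases hk : k = i <;> simpa [hk] using by assumption
    · rw [integral_fintype_prod_volume_eq_prod
        (fun k y => (if k = i then f y else 1) * φ y)]
      exact Finset.prod_eq_zero (Finset.mem_univ i) (by simpa using hf0)
  have key2 : ∀ i j, Integrable (fun x : ι → X => a i (x i) * b j (x j) * ∏ k, φ (x k)) ∧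
      ∫ x : ι → X, a i (x i) * b j (x j) * ∏ k, φ (x k) = if i = j then c i else 0 := by
    intro i j
    have e : (fun x : ι → X => a i (x i) * b j (x j) * ∏ k, φ (x k)) =
        fun x => ∏ k, (fun k y => (if k = i then a i y else 1) * (if k = j then b j y else 1)
          * φ y) k (x k) := by
      funext x
      simp only [Finset.prod_mul_distrib, Finset.prod_ite_eq', Finset.mem_univ, if_true]
    rw [e]
    refine ⟨Integrable.fintype_prod (μ := fun _ => volume)
      (f := fun k y => (if k = i then a i y else 1) * (if k = j then b j y else 1) * φ y) fun k => ?_, ?_⟩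
    · by_cases hi : k = i
      · by_cases hj : k = j
        · subst hi; subst hj; simpa using (h k).integrable_mul
        · subst hi; simpa [hj] using (h k).integrable_left
      · by_cases hj : k = j
        · subst hj; simpa [hi] using (h k).integrable_right
        · simpa [hi, hj] using hφ
    · rw [integral_fintype_prod_volume_eq_prod
        (fun k y => (if k = i then a i y else 1) * (if k = j then b j y else 1) * φ y)]
      split_ifs with hij
      · subst hij
        rw [Finset.prod_eq_single i]
        · simpa using (h i).cov
        · intro k _ hk
          simpa [hk] using hφ1
        · simp
      · exact Finset.prod_eq_zero (Finset.mem_univ i) (by simpa [hij] using (h i).mean_left)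
  have l1 : ∀ f : ι → X → ℝ, (fun x : ι → X => (∑ i, f i (x i)) * ∏ k, φ (x k)) =
      fun x => ∑ i, f i (x i) * ∏ k, φ (x k) := fun f => by
    funext x; rw [Finset.sum_mul]
  have l2 : (fun x : ι → X => (∑ i, a i (x i)) * (∑ i, b i (x i)) * ∏ k, φ (x k)) =
      fun x => ∑ i, ∑ j, a i (x i) * b j (x j) * ∏ k, φ (x k) := by
    funext x
    rw [Finset.sum_mul_sum, Finset.sum_mul]
    simp only [Finset.sum_mul]
  have ka := fun i => key1 (a i) (h i).integrable_left (h i).mean_left i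
  have kb := fun i => key1 (b i) (h i).integrable_right (h i).mean_right i
  refine ⟨Integrable.fintype_prod fun _ => hφ, ?_, ?_, ?_, ?_, ?_, ?_, ?_⟩
  · rw [integral_fintype_prod_volume_eq_prod (fun _ : ι => φ)]; simp [hφ1]
  · rw [l1]; exact integrable_finsetSum _ fun i _ => (ka i).1
  · rw [l1, integral_finsetSum _ fun i _ => (ka i).1]; simp [(ka _).2]
  · rw [l1]; exact integrable_finsetSum _ fun i _ => (kb i).1
  · rw [l1, integral_finsetSum _ fun i _ => (kb i).1]; simp [(kb _).2]
  · rw [l2]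
    exact integrable_finsetSum _ fun i _ => integrable_finsetSum _ fun j _ => (key2 i j).1
  · rw [l2, integral_finsetSum _ fun i _ => integrable_finsetSum _ fun j _ => (key2 i j).1]
    refine Finset.sum_congr rfl fun i _ => ?_
    rw [integral_finsetSum _ fun j _ => (key2 i j).1]
    simp [(key2 _ _).2]

theorem hasCentredCov_gaussianPDFReal (v : NNReal) (hv : v ≠ 0) (g h : ℝ) :
    HasCentredCov (ProbabilityTheory.gaussianPDFReal 0 v) (fun x => x * g) (fun x => x * h)
      (v * (g * h)) := by
  have tr : ∀ f : ℝ → ℝ, Integrable f (ProbabilityTheory.gaussianReal 0 v) →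
      Integrable (fun x => f x * ProbabilityTheory.gaussianPDFReal 0 v x) := by
    intro f hf
    rw [ProbabilityTheory.gaussianReal_of_var_ne_zero _ hv,
      integrable_withDensity_iff (ProbabilityTheory.measurable_gaussianPDF 0 v)
        (Filter.Eventually.of_forall fun _ => ProbabilityTheory.gaussianPDF_lt_top)] at hf
    simpa [ProbabilityTheory.toReal_gaussianPDF] using hf
  have tr2 : ∀ f : ℝ → ℝ, ∫ x, f x * ProbabilityTheory.gaussianPDFReal 0 v x =
      ∫ x, f x ∂(ProbabilityTheory.gaussianReal 0 v) := by
    intro f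
    rw [ProbabilityTheory.integral_gaussianReal_eq_integral_smul hv]
    simp [mul_comm]
  have i1 : Integrable (fun x : ℝ => x) (ProbabilityTheory.gaussianReal 0 v) :=
    (ProbabilityTheory.memLp_id_gaussianReal 1).integrable le_rfl
  have m1 : ∫ x : ℝ, x ∂(ProbabilityTheory.gaussianReal 0 v) = 0 :=
    ProbabilityTheory.integral_id_gaussianReal
  have i2 : Integrable (fun x : ℝ => x ^ 2) (ProbabilityTheory.gaussianReal 0 v) :=
    (ProbabilityTheory.memLp_id_gaussianReal 2).integrable_sq
  have m2 : ∫ x : ℝ, x ^ 2 ∂(ProbabilityTheory.gaussianReal 0 v) = v := by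
    have := ProbabilityTheory.variance_fun_id_gaussianReal (μ := 0) (v := v)
    rw [ProbabilityTheory.variance_of_integral_eq_zero (by fun_prop) m1] at this
    exact this
  have e : (fun x : ℝ => x * g * (x * h)) = fun x => x ^ 2 * (g * h) := by funext x; ring
  refine ⟨ProbabilityTheory.integrable_gaussianPDFReal 0 v,
    ProbabilityTheory.integral_gaussianPDFReal_eq_one 0 hv, tr _ (i1.mul_const g), ?_,
    tr _ (i1.mul_const h), ?_, tr (fun x => x * g * (x * h)) ?_, ?_⟩
  · rw [tr2, integral_mul_const, m1, zero_mul]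
  · rw [tr2, integral_mul_const, m1, zero_mul]
  · rw [e]; exact i2.mul_const _
  · rw [tr2 (fun x => x * g * (x * h)), e, integral_mul_const, m2]

theorem HasCentredCov.comp_measurePreserving {X Y : Type*} [MeasureSpace X] [MeasureSpace Y]
    {φ a b : Y → ℝ} {c : ℝ} (h : HasCentredCov φ a b c) {e : X ≃ᵐ Y}
    (he : MeasurePreserving e) :
    HasCentredCov (φ ∘ e) (a ∘ e) (b ∘ e) c := by
  have I : ∀ f : Y → ℝ, Integrable f → Integrable (fun x => f (e x)) := fun f hf =>
    (he.integrable_comp_emb e.measurableEmbedding).2 hf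
  have S : ∀ f : Y → ℝ, ∫ x, f (e x) = ∫ y, f y := fun f => he.integral_comp' f
  exact ⟨I _ h.integrable, (S _).trans h.integral_eq_one, I _ h.integrable_left,
    (S (fun y => a y * φ y)).trans h.mean_left, I _ h.integrable_right,
    (S (fun y => b y * φ y)).trans h.mean_right, I _ h.integrable_mul,
    (S (fun y => a y * b y * φ y)).trans h.cov⟩

/-- Density of the circular complex Gaussian law of power `s ^ 2`. -/
def complexGaussianPDF (s : ℝ) (z : ℂ) : ℝ :=
  (Real.pi * s ^ 2)⁻¹ * Real.exp (-(1 / s ^ 2) * ‖z‖ ^ 2)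

/-- Real and imaginary parts are independent real Gaussians of variance `s ^ 2 / 2`, and `Re (z̄ g)`
is the sum of one linear functional of each. -/
theorem hasCentredCov_complexGaussianPDF {s : ℝ} (hs : 0 < s) (g h : ℂ) :
    HasCentredCov (complexGaussianPDF s) (fun z => (star z * g).re) (fun z => (star z * h).re)
      (s ^ 2 / 2 * (star g * h).re) := by
  set v : NNReal := ⟨s ^ 2 / 2, by positivity⟩ with hv
  have hvv : (v : ℝ) = s ^ 2 / 2 := rfl
  have hv0 : v ≠ 0 := by
    intro h0
    have : (v : ℝ) = 0 := by rw [h0]; rfl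
    rw [hvv] at this
    exact absurd this (by positivity)
  have H := HasCentredCov.pi (ι := Fin 2) (ProbabilityTheory.integrable_gaussianPDFReal 0 v)
    (ProbabilityTheory.integral_gaussianPDFReal_eq_one 0 hv0)
    (fun i => hasCentredCov_gaussianPDFReal v hv0 (![g.re, g.im] i) (![h.re, h.im] i))
  have H' := H.comp_measurePreserving Complex.volume_preserving_equiv_pi
  convert H' using 1
  · funext z
    simp only [complexGaussianPDF, Function.comp, Fin.prod_univ_two,
      Complex.measurableEquivPi_apply, Matrix.cons_val_zero, Matrix.cons_val_one,
      ProbabilityTheory.gaussianPDFReal, hvv, sub_zero]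
    rw [mul_mul_mul_comm, ← Real.exp_add, ← mul_inv, Real.mul_self_sqrt (by positivity),
      Complex.sq_norm, Complex.normSq_apply]
    congr 2
    · ring
    · field_simp
      ring
  · funext z
    simp [Complex.measurableEquivPi_apply, Fin.sum_univ_two]
  · funext z
    simp [Complex.measurableEquivPi_apply, Fin.sum_univ_two]
  · simp only [Fin.sum_univ_two, hvv]
    simp
    ring

/-- Real inner product on arrays of `L` complex vectors. -/
def reInner {L N : ℕ} (x y : Fin L → Fin N → ℂ) : ℝ := ∑ l, ∑ k, (star (x l k) * y l k).re

theorem hasCentredCov_snapshots {s : ℝ} (hs : 0 < s) {L N : ℕ} (g h : Fin L → Fin N → ℂ) :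
    HasCentredCov (fun y : Fin L → Fin N → ℂ => ∏ l, ∏ k, complexGaussianPDF s (y l k))
      (fun y => reInner y g) (fun y => reInner y h) (s ^ 2 / 2 * reInner g h) := by
  -- With zero functionals, only the integrability and normalization of the density matter.
  have H0 := hasCentredCov_complexGaussianPDF hs 0 0
  have H1 := fun l => HasCentredCov.pi (ι := Fin N) H0.integrable H0.integral_eq_one
    fun k => hasCentredCov_complexGaussianPDF hs (g l k) (h l k)
  have H2 := HasCentredCov.pi (ι := Fin N) H0.integrable H0.integral_eq_one
    fun _ => H0
  have H3 := HasCentredCov.pi (ι := Fin L) H2.integrable H2.integral_eq_one H1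
  convert H3 using 1
  · rfl
  · rfl
  · simp only [reInner, Finset.mul_sum]

end

noncomputable section
open MeasureTheory

namespace FDA

variable (R : FDA) {N P L : ℕ}

/-! ### Derivatives of the steering vectors and of the echoes -/

theorem hasDerivAt_steer_direction (m : Fin N → ℝ) (θ r : ℝ) (k : Fin N) :
    HasDerivAt (fun t => R.steer m t r k)
      (-Complex.I * ((4 * Real.pi * R.fc * R.d * Real.cos θ / R.c : ℝ) : ℂ) *
        ((pos N k : ℂ) * R.steer m θ r k)) θ := by
  have h1 : HasDerivAt (fun t : ℝ => 4 * Real.pi * R.fc * R.d * Real.sin t / R.c * pos N k)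
      (4 * Real.pi * R.fc * R.d * Real.cos θ / R.c * pos N k) θ :=
    (((Real.hasDerivAt_sin θ).const_mul _).div_const _).mul_const _
  have h2 := (((h1.ofReal_comp).const_mul (-Complex.I)).cexp).mul_const (R.bR m r k)
  refine h2.congr_deriv ?_
  simp only [steer, bD]
  push_cast
  ring

theorem hasDerivAt_steer_range (m : Fin N → ℝ) (θ r : ℝ) (k : Fin N) :
    HasDerivAt (fun t => R.steer m θ t k)
      (-Complex.I * (((4 * Real.pi / R.c * R.fc : ℝ) : ℂ) * R.steer m θ r k +
        ((4 * Real.pi * R.Δf / R.c : ℝ) : ℂ) * ((m k : ℂ) * R.steer m θ r k))) r := by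
  have h1 : HasDerivAt (fun t : ℝ => 4 * Real.pi / R.c * R.fc * t)
      (4 * Real.pi / R.c * R.fc) r := by
    simpa using (hasDerivAt_id r).const_mul (4 * Real.pi / R.c * R.fc)
  have h2 : HasDerivAt (fun t : ℝ => 4 * Real.pi * R.Δf / R.c * m k * t)
      (4 * Real.pi * R.Δf / R.c * m k) r := by
    simpa using (hasDerivAt_id r).const_mul (4 * Real.pi * R.Δf / R.c * m k)
  have h3 := ((((h1.ofReal_comp).const_mul (-Complex.I)).cexp).mul
    (((h2.ofReal_comp).const_mul (-Complex.I)).cexp)).const_mul (R.bD N θ k)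
  refine h3.congr_deriv ?_
  simp only [steer, bR]
  push_cast
  ring

theorem matD_direction (m : Fin N → ℝ) (θ r : Fin P → ℝ) (k : Fin N) (i : Fin P) :
    R.matD m θ r k (i, 0) =
      -Complex.I * ((4 * Real.pi * R.fc * R.d * Real.cos (θ i) / R.c : ℝ) : ℂ) *
        R.weighted m θ r (pos N) i k :=
  (R.hasDerivAt_steer_direction m (θ i) (r i) k).deriv

theorem matD_range (m : Fin N → ℝ) (θ r : Fin P → ℝ) (k : Fin N) (i : Fin P) :
    R.matD m θ r k (i, 1) =
      -Complex.I * (((4 * Real.pi / R.c * R.fc : ℝ) : ℂ) * R.matA m θ r k i +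
        ((4 * Real.pi * R.Δf / R.c : ℝ) : ℂ) * R.weighted m θ r m i k) :=
  (R.hasDerivAt_steer_range m (θ i) (r i) k).deriv

/-- Partial derivatives of the echoes by the parameters. -/
def tangent (m : Fin N → ℝ) (θ r : Fin P → ℝ) (α : Fin L → Fin P → ℂ) :
    ParamIdx P L → Fin L → Fin N → ℂ :=
  Sum.elim (fun q l k => α l q.1 * R.matD m θ r k q)
    (fun q l k => if l = q.1 then ![1, Complex.I] q.2.2 * R.matA m θ r k q.2.1 else 0)

/-- Each parameter enters the summand of a single target, and an amplitude only the echo of its own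
snapshot; every other term is constant along the line. -/
theorem hasDerivAt_meanEcho (m : Fin N → ℝ) (θ r : Fin P → ℝ) (α : Fin L → Fin P → ℂ)
    (a : ParamIdx P L) (l : Fin L) (k : Fin N) :
    HasDerivAt (fun t : ℝ => R.meanEcho m (param θ r α + t • Pi.single a 1) l k)
      (R.tangent m θ r α a l k) 0 := by
  have hα : ∀ l i, ((α l i).re : ℂ) + Complex.I * ((α l i).im : ℂ) = α l i := fun l i => by
    rw [mul_comm]; exact Complex.re_add_im _
  rcases a with ⟨j, b⟩ | ⟨l', j, b⟩
  · have key : ∀ i : Fin P, HasDerivAt (fun t : ℝ =>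
        (((param θ r α + t • Pi.single (Sum.inl (j, b)) (1 : ℝ) : ParamIdx P L → ℝ) (Sum.inr (l, i, 0)) : ℂ) +
          Complex.I * ((param θ r α + t • Pi.single (Sum.inl (j, b)) (1 : ℝ) : ParamIdx P L → ℝ)
            (Sum.inr (l, i, 1)) : ℂ)) *
        R.steer m ((param θ r α + t • Pi.single (Sum.inl (j, b)) (1 : ℝ) : ParamIdx P L → ℝ) (Sum.inl (i, 0)))
          ((param θ r α + t • Pi.single (Sum.inl (j, b)) (1 : ℝ) : ParamIdx P L → ℝ) (Sum.inl (i, 1))) k)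
        (if i = j then α l j * R.matD m θ r k (j, b) else 0) 0 := by
      intro i
      by_cases hij : i = j
      · subst hij
        fin_cases b
        · simp [param, hα]
          refine HasDerivAt.const_mul _ ?_
          have h := R.hasDerivAt_steer_direction m (θ i) (r i) k
          rw [R.matD_direction]
          have h' : HasDerivAt (fun t : ℝ => θ i + t) 1 0 := by
            simpa using (hasDerivAt_id (0 : ℝ)).const_add (θ i)
          have := HasDerivAt.scomp (h := fun t : ℝ => θ i + t) (0 : ℝ)
            (by simpa using h) h'
          simpa [Function.comp_def, weighted] using this
        · simp [param, hα]
          refine HasDerivAt.const_mul _ ?_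
          have h := R.hasDerivAt_steer_range m (θ i) (r i) k
          rw [R.matD_range]
          have h' : HasDerivAt (fun t : ℝ => r i + t) 1 0 := by
            simpa using (hasDerivAt_id (0 : ℝ)).const_add (r i)
          have := HasDerivAt.scomp (h := fun t : ℝ => r i + t) (0 : ℝ)
            (by simpa using h) h'
          simpa [Function.comp_def, weighted, matA] using this
      · simp [param, hα, hij]
        exact hasDerivAt_const _ _
    have := HasDerivAt.fun_sum (u := Finset.univ) fun i _ => key i
    simpa [meanEcho, tangent] using this
  · have key : ∀ i : Fin P, HasDerivAt (fun t : ℝ =>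
        (((param θ r α + t • Pi.single (Sum.inr (l', j, b)) (1 : ℝ) : ParamIdx P L → ℝ) (Sum.inr (l, i, 0)) : ℂ) +
          Complex.I * ((param θ r α + t • Pi.single (Sum.inr (l', j, b)) (1 : ℝ) : ParamIdx P L → ℝ)
            (Sum.inr (l, i, 1)) : ℂ)) *
        R.steer m ((param θ r α + t • Pi.single (Sum.inr (l', j, b)) (1 : ℝ) : ParamIdx P L → ℝ) (Sum.inl (i, 0)))
          ((param θ r α + t • Pi.single (Sum.inr (l', j, b)) (1 : ℝ) : ParamIdx P L → ℝ) (Sum.inl (i, 1))) k)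
        (if i = j then (if l = l' then ![1, Complex.I] b * R.matA m θ r k j else 0) else 0) 0 := by
      intro i
      have h0 : HasDerivAt (fun t : ℝ => (t : ℂ)) 1 0 := Complex.ofRealCLM.hasDerivAt
      by_cases hij : l = l' ∧ i = j
      · obtain ⟨rfl, rfl⟩ := hij
        fin_cases b
        · simp [param]
          exact (((h0.const_add ((α l i).re : ℂ)).add_const
            (Complex.I * ((α l i).im : ℂ))).mul_const _).congr_deriv (one_mul _)
        · simp [param]
          exact ((((h0.const_add ((α l i).im : ℂ)).const_mul Complex.I).const_add
            ((α l i).re : ℂ)).mul_const _).congr_deriv (by rw [mul_one]; rfl)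
      · have : (if i = j then (if l = l' then ![1, Complex.I] b * R.matA m θ r k j else 0)
            else 0) = 0 := by
          split_ifs <;> simp_all
        rw [this]
        have h2 : ∀ b', (l, i, b') ≠ (l', j, b) := by
          intro b' h; simp only [Prod.mk.injEq] at h; exact hij ⟨h.1, h.2.1⟩
        simp [h2]
        exact hasDerivAt_const _ _
    have := HasDerivAt.fun_sum (u := Finset.univ) fun i _ => key i
    simpa [meanEcho, tangent] using this

/-! ### Score and Fisher information -/

theorem score_density (m : Fin N → ℝ) (θ r : Fin P → ℝ) (α : Fin L → Fin P → ℂ)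
    (a : ParamIdx P L) (y : Fin L → Fin N → ℂ) :
    score (R.density m) (param θ r α) a y =
      2 / R.σ ^ 2 * reInner (y - R.meanEcho m (param θ r α)) (R.tangent m θ r α a) := by
  have hσ := R.σ_pos
  have hlog : ∀ η : ParamIdx P L → ℝ, Real.log (R.density m η y) =
      Real.log (((Real.pi * R.σ ^ 2) ^ (N * L))⁻¹) +
        -(1 / R.σ ^ 2) * ∑ l, ∑ k, ‖y l k - R.meanEcho m η l k‖ ^ 2 := by
    intro η
    rw [density, Real.log_mul (by positivity) (Real.exp_pos _).ne', Real.log_exp]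
  have hd : ∀ l k, HasDerivAt
      (fun t : ℝ => ‖y l k - R.meanEcho m (param θ r α + t • Pi.single a 1) l k‖ ^ 2)
      (-2 * (star (y l k - R.meanEcho m (param θ r α) l k) * R.tangent m θ r α a l k).re) 0 := by
    intro l k
    have h := ((R.hasDerivAt_meanEcho m θ r α a l k).const_sub (y l k)).norm_sq
    refine h.congr_deriv ?_
    simp only [zero_smul, add_zero, Complex.inner, Complex.star_def, neg_mul,
      Complex.neg_re]
    rw [mul_comm (R.tangent m θ r α a l k)]
    ring
  have hs : HasDerivAt (fun t : ℝ => Real.log (((Real.pi * R.σ ^ 2) ^ (N * L))⁻¹) +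
        -(1 / R.σ ^ 2) * ∑ l, ∑ k,
          ‖y l k - R.meanEcho m (param θ r α + t • Pi.single a 1) l k‖ ^ 2)
      (-(1 / R.σ ^ 2) * ∑ l, ∑ k,
        (-2 * (star (y l k - R.meanEcho m (param θ r α) l k) * R.tangent m θ r α a l k).re)) 0 :=
    ((HasDerivAt.fun_sum fun l _ => HasDerivAt.fun_sum fun k _ => hd l k).const_mul _).const_add _
  rw [score, lineDeriv]
  simp only [hlog]
  rw [hs.deriv]
  simp only [reInner, ← Finset.mul_sum, Pi.sub_apply]
  ring

theorem density_eq_prod (m : Fin N → ℝ) (η : ParamIdx P L → ℝ) (y : Fin L → Fin N → ℂ) :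
    R.density m η y = ∏ l, ∏ k, complexGaussianPDF R.σ ((y - R.meanEcho m η) l k) := by
  simp only [complexGaussianPDF, Finset.prod_mul_distrib, ← Real.exp_sum, density,
    Finset.prod_const, Finset.card_univ, Fintype.card_fin, Pi.sub_apply, Finset.mul_sum]
  rw [inv_pow, inv_pow, pow_mul]

theorem fisherInformation_density (m : Fin N → ℝ) (θ r : Fin P → ℝ) (α : Fin L → Fin P → ℂ)
    (a b : ParamIdx P L) :
    fisherInformation (R.density m) (param θ r α) a b =
      2 / R.σ ^ 2 * reInner (R.tangent m θ r α a) (R.tangent m θ r α b) := by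
  have hσ := R.σ_pos
  have h := (hasCentredCov_snapshots hσ (R.tangent m θ r α a) (R.tangent m θ r α b)).cov
  simp only [fisherInformation, Matrix.of_apply, score_density, density_eq_prod]
  -- Translation invariance of Lebesgue measure recentres the observations to pure noise.
  rw [integral_sub_right_eq_self (fun v : Fin L → Fin N → ℂ =>
    2 / R.σ ^ 2 * reInner v (R.tangent m θ r α a) * (2 / R.σ ^ 2 * reInner v
      (R.tangent m θ r α b)) * ∏ l, ∏ k, complexGaussianPDF R.σ (v l k))]
  have e : ∀ v : Fin L → Fin N → ℂ,
      2 / R.σ ^ 2 * reInner v (R.tangent m θ r α a) * (2 / R.σ ^ 2 * reInner v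
        (R.tangent m θ r α b)) * ∏ l, ∏ k, complexGaussianPDF R.σ (v l k) =
      (2 / R.σ ^ 2) ^ 2 * (reInner v (R.tangent m θ r α a) * reInner v
        (R.tangent m θ r α b) * ∏ l, ∏ k, complexGaussianPDF R.σ (v l k)) := fun v => by ring
  simp only [e]
  rw [integral_const_mul, h]
  field_simp

end FDA

end

noncomputable section

/-! ### The Cramér–Rao bound of a positive semidefinite information matrix -/

theorem crb_eq_top {ι : Type*} [Fintype ι] {J : Matrix ι ι ℝ} {k : ι} {u : ι → ℝ}
    (hu : u k ≠ 0) (h0 : u ⬝ᵥ (J *ᵥ u) = 0) : crb J k = ⊤ := by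
  refine top_le_iff.1 (le_trans ?_ (le_iSup _ u))
  rw [h0, ENNReal.ofReal_zero, ENNReal.div_zero]
  exact (ENNReal.ofReal_pos.2 (by positivity)).ne'

/-- Pairing with `w` in the form `J` reads off the `k`-th coordinate, so Cauchy–Schwarz bounds every
quotient by `w k`, with equality at `u = w`. Invertibility of `J` is not needed. -/
theorem crb_eq_of_mulVec_eq_single {ι : Type*} [Fintype ι] [DecidableEq ι] {J : Matrix ι ι ℝ}
    (hs : J.IsSymm) (hp : ∀ u, 0 ≤ u ⬝ᵥ (J *ᵥ u)) {k : ι} {w : ι → ℝ}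
    (hw : J *ᵥ w = Pi.single k 1) : crb J k = ENNReal.ofReal (w k) := by
  have hu : ∀ u, u ⬝ᵥ (J *ᵥ w) = u k := fun u => by rw [hw]; simp
  have hu' : ∀ u, w ⬝ᵥ (J *ᵥ u) = u k := fun u => by
    rw [Matrix.dotProduct_mulVec, ← Matrix.mulVec_transpose, hs.eq, hw]; simp
  have hq : ∀ (u : ι → ℝ) (t : ℝ), 0 ≤ u ⬝ᵥ (J *ᵥ u) - 2 * t * u k + t ^ 2 * w k := by
    intro u t
    have h := hp (u - t • w)
    simp only [Matrix.mulVec_sub, Matrix.mulVec_smul, sub_dotProduct, dotProduct_sub,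
      smul_dotProduct, dotProduct_smul, hu, hu', smul_eq_mul, Pi.sub_apply, Pi.smul_apply] at h
    linarith [h]
  have hw0 : 0 ≤ w k := by simpa [hu] using hp w
  have hwk : 0 < w k := by
    refine lt_of_le_of_ne hw0 fun h => ?_
    set e : ι → ℝ := Pi.single k 1
    have he : e k = 1 := by simp [e]
    -- If `w k` were 0, the polynomial in `t` would be affine with slope -2; this `t` makes its
    -- value -1.
    have := hq e ((e ⬝ᵥ (J *ᵥ e) + 1) / 2)
    rw [← h, he] at this
    linarith
  have hcs : ∀ u, u k ^ 2 ≤ w k * (u ⬝ᵥ (J *ᵥ u)) := by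
    intro u
    -- This `t` minimizes the quadratic polynomial.
    have h := hq u (u k / w k)
    have e : u ⬝ᵥ (J *ᵥ u) - 2 * (u k / w k) * u k + (u k / w k) ^ 2 * w k =
        (w k * (u ⬝ᵥ (J *ᵥ u)) - u k ^ 2) / w k := by field_simp; ring
    rw [e, le_div_iff₀ hwk] at h
    linarith
  apply le_antisymm
  · refine iSup_le fun u => ENNReal.div_le_of_le_mul ?_
    rw [← ENNReal.ofReal_mul hw0]
    exact ENNReal.ofReal_le_ofReal (hcs u)
  · refine le_trans (le_of_eq ?_) (le_iSup _ w)
    rw [hu, ← ENNReal.ofReal_div_of_pos hwk]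
    congr 1
    field_simp

theorem crb_eq_inv {ι : Type*} [Fintype ι] [DecidableEq ι] {J : Matrix ι ι ℝ}
    (hs : J.IsSymm) (hp : ∀ u, 0 ≤ u ⬝ᵥ (J *ᵥ u)) (hJ : IsUnit J.det) (k : ι) :
    crb J k = ENNReal.ofReal (J⁻¹ k k) := by
  refine crb_eq_of_mulVec_eq_single (w := fun i => J⁻¹ i k) hs hp ?_
  have : (fun i => J⁻¹ i k) = J⁻¹ *ᵥ Pi.single k 1 := by ext i; simp
  rw [this, Matrix.mulVec_mulVec, Matrix.mul_nonsing_inv _ hJ, Matrix.one_mulVec]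

/-! ### The real inner product of arrays -/

section reInner

variable {L N : ℕ}

theorem reInner_comm (x y : Fin L → Fin N → ℂ) : reInner x y = reInner y x := by
  refine Finset.sum_congr rfl fun l _ => Finset.sum_congr rfl fun k _ => ?_
  simp only [Complex.star_def, Complex.mul_re, Complex.conj_re, Complex.conj_im]
  ring

theorem reInner_sub_right (x y z : Fin L → Fin N → ℂ) :
    reInner x (y - z) = reInner x y - reInner x z := by
  simp [reInner, mul_sub, Finset.sum_sub_distrib]

theorem reInner_sum_smul_right {ι : Type*} [Fintype ι] (x : Fin L → Fin N → ℂ) (c : ι → ℝ)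
    (y : ι → Fin L → Fin N → ℂ) :
    reInner x (∑ i, c i • y i) = ∑ i, c i * reInner x (y i) := by
  simp only [reInner, Finset.sum_apply, Pi.smul_apply, Finset.mul_sum, Complex.re_sum]
  symm
  rw [Finset.sum_comm]
  refine Finset.sum_congr rfl fun l _ => ?_
  rw [Finset.sum_comm]
  refine Finset.sum_congr rfl fun k _ => Finset.sum_congr rfl fun i _ => ?_
  rw [mul_smul_comm, Complex.smul_re, smul_eq_mul]

theorem reInner_self (x : Fin L → Fin N → ℂ) : reInner x x = ∑ l, ∑ k, ‖x l k‖ ^ 2 := by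
  refine Finset.sum_congr rfl fun l _ => Finset.sum_congr rfl fun k _ => ?_
  rw [Complex.sq_norm, Complex.star_def, ← Complex.normSq_eq_conj_mul_self, Complex.ofReal_re]

theorem reInner_self_nonneg (x : Fin L → Fin N → ℂ) : 0 ≤ reInner x x := by
  rw [reInner_self]; positivity

theorem reInner_self_eq_zero {x : Fin L → Fin N → ℂ} (h : reInner x x = 0) : x = 0 := by
  rw [reInner_self, Finset.sum_eq_zero_iff_of_nonneg fun _ _ => by positivity] at h
  ext l k
  have := (Finset.sum_eq_zero_iff_of_nonneg fun _ _ => by positivity).1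
    (h l (Finset.mem_univ _)) k (Finset.mem_univ _)
  simpa using this

theorem dotProduct_gram_mulVec {ι : Type*} [Fintype ι] {J : Matrix ι ι ℝ} {c : ℝ}
    {y : ι → Fin L → Fin N → ℂ} (hJ : ∀ p q, J p q = c * reInner (y p) (y q)) (u : ι → ℝ) :
    u ⬝ᵥ (J *ᵥ u) = c * reInner (∑ i, u i • y i) (∑ i, u i • y i) := by
  rw [reInner_sum_smul_right, dotProduct, Finset.mul_sum]
  refine Finset.sum_congr rfl fun p _ => ?_
  rw [reInner_comm, reInner_sum_smul_right, Matrix.mulVec, dotProduct, Finset.mul_sum,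
    Finset.mul_sum, Finset.mul_sum]
  refine Finset.sum_congr rfl fun q _ => ?_
  rw [hJ]
  ring

end reInner

/-! ### The Schur complement of a Gram matrix -/

/-- A solution of the normal equations replaces the explicit inverse of the nuisance block. -/
theorem efficientInformation_eq {ι κ : Type*} [Fintype κ] [DecidableEq κ]
    {F : Matrix (ι ⊕ κ) (ι ⊕ κ) ℝ} {X : Matrix κ ι ℝ}
    (hinj : ∀ x, F.toBlocks₂₂ *ᵥ x = 0 → x = 0) (hX : F.toBlocks₂₂ * X = F.toBlocks₂₁) :
    efficientInformation F = F.toBlocks₁₁ - F.toBlocks₁₂ * X := by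
  have hdet : IsUnit F.toBlocks₂₂.det := by
    rw [← Matrix.isUnit_iff_isUnit_det, ← Matrix.mulVec_injective_iff_isUnit]
    intro x y hxy
    exact sub_eq_zero.1 (hinj _ (by rw [Matrix.mulVec_sub]; exact sub_eq_zero.2 hxy))
  rw [efficientInformation, ← hX, Matrix.mul_assoc, Matrix.nonsing_inv_mul_cancel_left _ _ hdet]

/-! ### The projection onto the orthogonal complement of a column space -/

section Projection

open scoped ComplexOrder in
theorem isUnit_det_conjTranspose_mul_self {n p : Type*} [Fintype n] [Fintype p]
    [DecidableEq p] {A : Matrix n p ℂ} (hA : Function.Injective A.mulVec) :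
    IsUnit (Aᴴ * A).det :=
  (Matrix.isUnit_iff_isUnit_det _).1 (Matrix.PosDef.conjTranspose_mul_self A hA).isUnit

variable {n p : Type*} [Fintype n] [DecidableEq n] [Fintype p] [DecidableEq p]

/-- Orthogonal projection onto the complement of the column space of `A`. -/
def perp (A : Matrix n p ℂ) : Matrix n n ℂ := 1 - A * (Aᴴ * A)⁻¹ * Aᴴ

theorem perp_conjTranspose (A : Matrix n p ℂ) : (perp A)ᴴ = perp A := by
  simp only [perp, Matrix.conjTranspose_sub, Matrix.conjTranspose_one, Matrix.conjTranspose_mul,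
    Matrix.conjTranspose_conjTranspose, Matrix.conjTranspose_nonsing_inv, Matrix.mul_assoc]

theorem perp_mul {A : Matrix n p ℂ} (hA : Function.Injective A.mulVec) : perp A * A = 0 := by
  rw [perp, Matrix.sub_mul, Matrix.one_mul, Matrix.mul_assoc, Matrix.mul_assoc,
    Matrix.nonsing_inv_mul _ (isUnit_det_conjTranspose_mul_self hA), Matrix.mul_one, sub_self]

theorem conjTranspose_mul_perp {A : Matrix n p ℂ} (hA : Function.Injective A.mulVec) :
    Aᴴ * perp A = 0 := by
  rw [← perp_conjTranspose, ← Matrix.conjTranspose_mul, perp_mul hA, Matrix.conjTranspose_zero]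

theorem perp_mul_perp {A : Matrix n p ℂ} (hA : Function.Injective A.mulVec) :
    perp A * perp A = perp A := by
  nth_rw 2 [perp]
  rw [Matrix.mul_sub, Matrix.mul_one, ← Matrix.mul_assoc, ← Matrix.mul_assoc, perp_mul hA,
    Matrix.zero_mul, Matrix.zero_mul, sub_zero]

theorem perp_mulVec_mulVec {A : Matrix n p ℂ} (hA : Function.Injective A.mulVec) (c : p → ℂ) :
    perp A *ᵥ (A *ᵥ c) = 0 := by
  rw [Matrix.mulVec_mulVec, perp_mul hA, Matrix.zero_mulVec]

/-- The equation itself displays `v` as `A` times a vector, so no rank assumption is required. -/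
theorem exists_of_perp_mulVec_eq_zero {A : Matrix n p ℂ} {v : n → ℂ} (h : perp A *ᵥ v = 0) :
    ∃ c, v = A *ᵥ c := by
  refine ⟨((Aᴴ * A)⁻¹ * Aᴴ) *ᵥ v, ?_⟩
  rw [perp, Matrix.sub_mulVec, Matrix.one_mulVec, sub_eq_zero] at h
  rw [Matrix.mulVec_mulVec, ← Matrix.mul_assoc]
  exact h

end Projection

namespace FDA

variable (R : FDA) {N P L : ℕ}

theorem projPerp_eq_perp (m : Fin N → ℝ) (θ r : Fin P → ℝ) :
    R.projPerp m θ r = perp (R.matA m θ r) := rfl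

theorem matA_mulVec (m : Fin N → ℝ) (θ r : Fin P → ℝ) (c : Fin P → ℂ) :
    R.matA m θ r *ᵥ c = ∑ i, c i • R.steer m (θ i) (r i) := by
  ext k
  simp [Matrix.mulVec, dotProduct, matA, mul_comm]

theorem matA_mulVec_injective {m : Fin N → ℝ} {θ r : Fin P → ℝ}
    (h : LinearIndependent ℂ fun i => R.steer m (θ i) (r i)) :
    Function.Injective (R.matA m θ r).mulVec := by
  intro x y hxy
  rw [← sub_eq_zero]
  rw [← sub_eq_zero, ← Matrix.mulVec_sub, matA_mulVec] at hxy
  exact funext (Fintype.linearIndependent_iff.1 h _ hxy)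

/-! ### Fisher information of the location parameters -/

/-- Derivatives of the echoes by the location parameters, projected onto the complement of the
derivatives by the amplitudes. -/
def projTangent (m : Fin N → ℝ) (θ r : Fin P → ℝ) (α : Fin L → Fin P → ℂ) (q : LocIdx P) :
    Fin L → Fin N → ℂ :=
  fun l k => α l q.1 * (R.projPerp m θ r * R.matD m θ r) k q

/-- The two real amplitude coordinates act as one complex coefficient; this identifies the nuisance
tangent space with a copy of the column space of `A` for each snapshot. -/
theorem sum_smul_tangent_amp (m : Fin N → ℝ) (θ r : Fin P → ℝ) (α : Fin L → Fin P → ℂ)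
    (x : AmpIdx P L → ℝ) (l : Fin L) (k : Fin N) :
    (∑ b, x b • R.tangent m θ r α (Sum.inr b)) l k =
      (R.matA m θ r *ᵥ fun i => (x (l, i, 0) : ℂ) + Complex.I * x (l, i, 1)) k := by
  simp only [Finset.sum_apply, Pi.smul_apply, tangent, Sum.elim_inr, Fintype.sum_prod_type,
    Fin.sum_univ_two, Matrix.mulVec, dotProduct]
  rw [Finset.sum_eq_single l]
  · refine Finset.sum_congr rfl fun i _ => ?_
    simp
    ring
  · intro l' _ hl
    simp [hl.symm]
  · simp

theorem reInner_tangent_amp_projTangent {m : Fin N → ℝ} {θ r : Fin P → ℝ}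
    (h : LinearIndependent ℂ fun i => R.steer m (θ i) (r i)) (α : Fin L → Fin P → ℂ)
    (b : AmpIdx P L) (q : LocIdx P) :
    reInner (R.tangent m θ r α (Sum.inr b)) (R.projTangent m θ r α q) = 0 := by
  obtain ⟨l, i, a⟩ := b
  have h0 : ∑ k, star (R.matA m θ r k i) * (R.projPerp m θ r * R.matD m θ r) k q = 0 := by
    have : ((R.matA m θ r)ᴴ * (R.projPerp m θ r * R.matD m θ r)) i q = 0 := by
      rw [← Matrix.mul_assoc, projPerp_eq_perp,
        conjTranspose_mul_perp (R.matA_mulVec_injective h), Matrix.zero_mul]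
      rfl
    exact this
  rw [reInner, Finset.sum_eq_single l]
  · rw [← Complex.re_sum]
    have e : ∑ k, star (R.tangent m θ r α (Sum.inr (l, i, a)) l k) * R.projTangent m θ r α q l k =
        star (![1, Complex.I] a) * α l q.1 *
          ∑ k, star (R.matA m θ r k i) * (R.projPerp m θ r * R.matD m θ r) k q := by
      rw [Finset.mul_sum]
      refine Finset.sum_congr rfl fun k _ => ?_
      simp only [tangent, Sum.elim_inr, if_true, projTangent, star_mul']
      ring
    rw [e, h0, mul_zero, Complex.zero_re]
  · intro l' _ hl
    simp [tangent, hl]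
  · simp

/-- Eliminating the amplitudes is a least-squares regression of the location derivatives on the
amplitude derivatives; what remains is the Gram matrix of the residuals. -/
theorem fimLoc_apply {m : Fin N → ℝ} {θ r : Fin P → ℝ}
    (h : LinearIndependent ℂ fun i => R.steer m (θ i) (r i)) (α : Fin L → Fin P → ℂ)
    (p q : LocIdx P) :
    R.fimLoc m θ r α p q =
      2 / R.σ ^ 2 * reInner (R.projTangent m θ r α p) (R.projTangent m θ r α q) := by
  have hσ := R.σ_pos
  set F := fisherInformation (R.density m) (param θ r α) with hF
  have hFa : ∀ a b, F a b = 2 / R.σ ^ 2 *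
    reInner (R.tangent m θ r α a) (R.tangent m θ r α b) := R.fisherInformation_density m θ r α
  -- Complex regression coefficients of `D` on `A`. Multiplied by the amplitudes and split into real
  -- and imaginary parts, they give the solution `X` of the normal equations.
  set Z : Matrix (Fin P) (LocIdx P) ℂ :=
    ((R.matA m θ r)ᴴ * R.matA m θ r)⁻¹ * (R.matA m θ r)ᴴ * R.matD m θ r with hZ
  set X : Matrix (AmpIdx P L) (LocIdx P) ℝ := Matrix.of fun b q =>
    ![(α b.1 q.1 * Z b.2.1 q).re, (α b.1 q.1 * Z b.2.1 q).im] b.2.2 with hX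
  have hXs : ∀ q, ∑ b, X b q • R.tangent m θ r α (Sum.inr b) =
      R.tangent m θ r α (Sum.inl q) - R.projTangent m θ r α q := by
    intro q
    funext l k
    rw [sum_smul_tangent_amp]
    have e : (fun i => ((X (l, i, 0) q : ℝ) : ℂ) + Complex.I * ((X (l, i, 1) q : ℝ) : ℂ)) =
        α l q.1 • fun i => Z i q := by
      funext i
      simp only [hX, Matrix.of_apply, Matrix.cons_val_zero, Matrix.cons_val_one]
      rw [mul_comm Complex.I, Complex.re_add_im]
      rfl
    have e2 : R.projPerp m θ r * R.matD m θ r = R.matD m θ r - R.matA m θ r * Z := by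
      rw [projPerp, hZ, Matrix.sub_mul, Matrix.one_mul]
      simp only [Matrix.mul_assoc]
    rw [e, Matrix.mulVec_smul]
    simp only [Pi.smul_apply, Pi.sub_apply, tangent, Sum.elim_inl, projTangent, e2,
      Matrix.sub_apply, smul_eq_mul]
    have : (R.matA m θ r *ᵥ fun i => Z i q) k = (R.matA m θ r * Z) k q := rfl
    rw [this]
    ring
  have hFX : ∀ a q, ∑ b, F a (Sum.inr b) * X b q = 2 / R.σ ^ 2 *
      (reInner (R.tangent m θ r α a) (R.tangent m θ r α (Sum.inl q)) -
        reInner (R.tangent m θ r α a) (R.projTangent m θ r α q)) := by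
    intro a q
    rw [← reInner_sub_right, ← hXs, reInner_sum_smul_right, Finset.mul_sum]
    refine Finset.sum_congr rfl fun b _ => ?_
    rw [hFa]
    ring
  have hinj : ∀ x, F.toBlocks₂₂ *ᵥ x = 0 → x = 0 := by
    intro x hx
    have h1 := dotProduct_gram_mulVec (J := F.toBlocks₂₂) (c := 2 / R.σ ^ 2)
      (y := fun b => R.tangent m θ r α (Sum.inr b)) (fun a b => hFa _ _) x
    rw [hx, dotProduct_zero] at h1
    have h2 := reInner_self_eq_zero
      ((mul_eq_zero.1 h1.symm).resolve_left (by positivity))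
    have h3 : ∀ l, (fun i => (x (l, i, 0) : ℂ) + Complex.I * x (l, i, 1)) = 0 := by
      intro l
      apply R.matA_mulVec_injective h
      rw [Matrix.mulVec_zero]
      funext k
      rw [← R.sum_smul_tangent_amp m θ r α x l k, h2]
      rfl
    funext ⟨l, i, a⟩
    have h4 := congrFun (h3 l) i
    have hre := congrArg Complex.re h4
    have him := congrArg Complex.im h4
    fin_cases a
    · simpa using hre
    · simpa using him
  have hX2 : F.toBlocks₂₂ * X = F.toBlocks₂₁ := by
    ext b q
    have := hFX (Sum.inr b) q
    rw [R.reInner_tangent_amp_projTangent h, sub_zero, ← hFa] at this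
    exact this
  -- One projection suffices in the inner product, because the removed part is a combination of
  -- amplitude tangents, which are orthogonal to every residual.
  have hproj : reInner (R.projTangent m θ r α p) (R.projTangent m θ r α q) =
      reInner (R.tangent m θ r α (Sum.inl p)) (R.projTangent m θ r α q) := by
    have : R.projTangent m θ r α p = R.tangent m θ r α (Sum.inl p) -
        ∑ b, X b p • R.tangent m θ r α (Sum.inr b) := by rw [hXs]; abel
    rw [this, reInner_comm, reInner_sub_right, reInner_sum_smul_right, reInner_comm]
    simp [reInner_comm (R.projTangent m θ r α q), R.reInner_tangent_amp_projTangent h]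
  have hmain : R.fimLoc m θ r α p q = F (Sum.inl p) (Sum.inl q) -
      ∑ b, F (Sum.inl p) (Sum.inr b) * X b q := by
    rw [fimLoc, ← hF, efficientInformation_eq hinj hX2]
    rfl
  rw [hmain, hFX, hFa, hproj]
  ring

/-- `P_A^⊥` is Hermitian and idempotent, so `C` is the Gram matrix of the columns of `P_A^⊥ D`; the
amplitudes factor out in each snapshot. -/
theorem projTangent_reInner {m : Fin N → ℝ} {θ r : Fin P → ℝ}
    (h : LinearIndependent ℂ fun i => R.steer m (θ i) (r i)) (α : Fin L → Fin P → ℂ)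
    (p q : LocIdx P) :
    reInner (R.projTangent m θ r α p) (R.projTangent m θ r α q) =
      (R.matC m θ r p q * ∑ l, α l q.1 * star (α l p.1)).re := by
  have hC : R.matC m θ r =
      (R.projPerp m θ r * R.matD m θ r)ᴴ * (R.projPerp m θ r * R.matD m θ r) := by
    rw [matC, Matrix.conjTranspose_mul, projPerp_eq_perp, perp_conjTranspose, Matrix.mul_assoc,
      Matrix.mul_assoc, ← Matrix.mul_assoc (perp _) (perp _),
      perp_mul_perp (R.matA_mulVec_injective h)]
  rw [hC, Matrix.mul_apply, reInner, Finset.mul_sum, Complex.re_sum]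
  refine Finset.sum_congr rfl fun l _ => ?_
  rw [Finset.sum_mul, Complex.re_sum]
  refine Finset.sum_congr rfl fun k _ => congrArg Complex.re ?_
  simp only [projTangent, star_mul', Matrix.conjTranspose_apply]
  ring

/-- The information matrix `Re {(Dᴴ P_A^⊥ D) ⊙ (Tᵀ ⊗ 1)}` for an amplitude covariance `T`. -/
def infoMat (m : Fin N → ℝ) (θ r : Fin P → ℝ) (T : Matrix (Fin P) (Fin P) ℂ) :
    Matrix (LocIdx P) (LocIdx P) ℝ :=
  (Matrix.hadamard (R.matC m θ r)
    (Tᵀ ⊗ₖ (Matrix.of fun _ _ : Fin 2 => (1 : ℂ)))).map Complex.re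

theorem infoMat_apply (m : Fin N → ℝ) (θ r : Fin P → ℝ) (T : Matrix (Fin P) (Fin P) ℂ)
    (p q : LocIdx P) :
    R.infoMat m θ r T p q = (R.matC m θ r p q * T q.1 p.1).re := by
  simp [infoMat, Matrix.kroneckerMap_apply]

theorem fimLoc_eq {m : Fin N → ℝ} {θ r : Fin P → ℝ}
    (h : LinearIndependent ℂ fun i => R.steer m (θ i) (r i)) (α : Fin L → Fin P → ℂ) :
    R.fimLoc m θ r α = (2 * (L : ℝ) / R.σ ^ 2) • R.infoMat m θ r (sampleCov α) := by
  ext p q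
  rw [R.fimLoc_apply h, R.projTangent_reInner h, Matrix.smul_apply, infoMat_apply, sampleCov,
    Matrix.of_apply]
  -- Without snapshots both sides vanish, and the cancellation of `1 / L` below would fail.
  rcases Nat.eq_zero_or_pos L with rfl | hL
  · simp
  · have hL' : (L : ℝ) ≠ 0 := by positivity
    have e : R.matC m θ r p q * (1 / (L : ℂ) * ∑ l, α l q.1 * star (α l p.1)) =
        ((1 / (L : ℝ) : ℝ) : ℂ) * (R.matC m θ r p q * ∑ l, α l q.1 * star (α l p.1)) := by
      push_cast; ring
    rw [e, Complex.re_ofReal_mul, smul_eq_mul]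
    field_simp

theorem fimLoc_isSymm {m : Fin N → ℝ} {θ r : Fin P → ℝ}
    (h : LinearIndependent ℂ fun i => R.steer m (θ i) (r i)) (α : Fin L → Fin P → ℂ) :
    (R.fimLoc m θ r α).IsSymm := by
  ext p q
  rw [Matrix.transpose_apply, R.fimLoc_apply h, R.fimLoc_apply h, reInner_comm]

theorem fimLoc_quadratic_nonneg {m : Fin N → ℝ} {θ r : Fin P → ℝ}
    (h : LinearIndependent ℂ fun i => R.steer m (θ i) (r i)) (α : Fin L → Fin P → ℂ)
    (u : LocIdx P → ℝ) : 0 ≤ u ⬝ᵥ (R.fimLoc m θ r α *ᵥ u) := by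
  rw [dotProduct_gram_mulVec (R.fimLoc_apply h α)]
  exact mul_nonneg (by positivity) (reInner_self_nonneg _)

end FDA

end

noncomputable section

namespace FDA

variable (R : FDA) {N P L : ℕ}

/-! ### The coefficient `γ` -/

/-- Real inner product of complex vectors. -/
def reDot (x y : Fin N → ℂ) : ℝ := (star x ⬝ᵥ y).re

theorem sqNorm_eq_reDot (x : Fin N → ℂ) : sqNorm x = reDot x x := by
  simp only [sqNorm, reDot, dotProduct, Complex.re_sum]
  refine Finset.sum_congr rfl fun k _ => ?_
  rw [Pi.star_apply, Complex.sq_norm, Complex.star_def, ← Complex.normSq_eq_conj_mul_self,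
    Complex.ofReal_re]

theorem reDot_comm (x y : Fin N → ℂ) : reDot x y = reDot y x := by
  simp only [reDot, dotProduct, Complex.re_sum]
  refine Finset.sum_congr rfl fun k _ => ?_
  simp only [Pi.star_apply, Complex.star_def, Complex.mul_re, Complex.conj_re, Complex.conj_im]
  ring

theorem reDot_add_right (x y z : Fin N → ℂ) : reDot x (y + z) = reDot x y + reDot x z := by
  simp [reDot]

theorem reDot_smul_right (t : ℝ) (x y : Fin N → ℂ) : reDot x (t • y) = t * reDot x y := by
  rw [reDot, reDot, dotProduct_smul, Complex.smul_re, smul_eq_mul]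

theorem reDot_add_left (x y z : Fin N → ℂ) : reDot (x + y) z = reDot x z + reDot y z := by
  rw [reDot_comm, reDot_add_right, reDot_comm z, reDot_comm z]

theorem reDot_smul_left (t : ℝ) (x y : Fin N → ℂ) : reDot (t • x) y = t * reDot x y := by
  rw [reDot_comm, reDot_smul_right, reDot_comm]

theorem reDot_self_nonneg (x : Fin N → ℂ) : 0 ≤ reDot x x := by
  rw [← sqNorm_eq_reDot, sqNorm]; positivity

theorem reDot_self_eq_zero {x : Fin N → ℂ} (h : reDot x x = 0) : x = 0 := by
  rw [← sqNorm_eq_reDot, sqNorm, Finset.sum_eq_zero_iff_of_nonneg fun _ _ => by positivity] at h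
  ext k
  simpa using h k (Finset.mem_univ _)

theorem reDot_sq_le (x y : Fin N → ℂ) : reDot x y ^ 2 ≤ reDot x x * reDot y y := by
  rcases eq_or_lt_of_le (reDot_self_nonneg y) with hy | hy
  · rw [reDot_self_eq_zero hy.symm]
    simp [reDot]
  -- This vector is `⟨y, y⟩` times the component of `x` orthogonal to `y`.
  · have h := reDot_self_nonneg (reDot y y • x + (-reDot x y) • y)
    simp only [reDot_add_left, reDot_add_right, reDot_smul_left, reDot_smul_right,
      reDot_comm y x] at h
    have : 0 ≤ reDot y y * (reDot x x * reDot y y - reDot x y ^ 2) := by nlinarith [h]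
    linarith [nonneg_of_mul_nonneg_right this hy]

theorem reDot_sq_eq_iff (x y : Fin N → ℂ) : reDot x x * reDot y y - reDot x y ^ 2 = 0 ↔
    ∃ s t : ℝ, s • x + t • y = 0 ∧ ¬(s = 0 ∧ t = 0) := by
  constructor
  · intro h
    rcases eq_or_lt_of_le (reDot_self_nonneg y) with hy | hy
    · exact ⟨0, 1, by rw [reDot_self_eq_zero hy.symm]; simp, by simp⟩
    · refine ⟨reDot y y, -reDot x y, reDot_self_eq_zero ?_, fun h0 => hy.ne' h0.1⟩
      simp only [reDot_add_left, reDot_add_right, reDot_smul_left, reDot_smul_right,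
        reDot_comm y x]
      linear_combination reDot y y * h
  · rintro ⟨s, t, h, hst⟩
    have h1 : s * reDot x x + t * reDot x y = 0 := by
      rw [← reDot_smul_right, ← reDot_smul_right, ← reDot_add_right, h]; simp [reDot]
    have h2 : s * reDot x y + t * reDot y y = 0 := by
      rw [reDot_comm x y, ← reDot_smul_right, ← reDot_smul_right, ← reDot_add_right, h]
      simp [reDot]
    by_cases hs : s = 0
    · have ht : t ≠ 0 := fun ht => hst ⟨hs, ht⟩
      apply mul_left_cancel₀ ht
      linear_combination reDot x x * h2 - reDot x y * h1
    · apply mul_left_cancel₀ hs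
      linear_combination reDot y y * h1 - reDot x y * h2

section LinearlyIndependent

variable {m : Fin N → ℝ} {θ r : Fin P → ℝ}
  (h : LinearIndependent ℂ fun i => R.steer m (θ i) (r i))
include h

theorem star_projected_dotProduct (v w : Fin N → ℂ) :
    star (R.projPerp m θ r *ᵥ v) ⬝ᵥ (R.projPerp m θ r *ᵥ w) =
      star v ⬝ᵥ (R.projPerp m θ r *ᵥ w) := by
  rw [Matrix.star_mulVec, ← Matrix.dotProduct_mulVec, Matrix.mulVec_mulVec, projPerp_eq_perp,
    perp_conjTranspose, perp_mul_perp (R.matA_mulVec_injective h)]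

/-- The two halves in the definition combine to the square of the real part of the cross term,
leaving a real Gram determinant. -/
theorem gam_eq (i : Fin P) : R.gam m θ r i =
    reDot (R.projected m θ r m i) (R.projected m θ r m i) *
      reDot (R.projected m θ r (pos N) i) (R.projected m θ r (pos N) i) -
      reDot (R.projected m θ r m i) (R.projected m θ r (pos N) i) ^ 2 := by
  rw [gam, sqNorm_eq_reDot, sqNorm_eq_reDot]
  have hc : R.cross m θ r i =
      star (R.projected m θ r m i) ⬝ᵥ R.projected m θ r (pos N) i :=
    (R.star_projected_dotProduct h _ _).symm
  rw [← hc.symm.subst (motive := fun z => z.re = reDot _ _) rfl, Complex.sq_norm,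
    Complex.normSq_apply, sq (R.cross m θ r i), Complex.mul_re]
  ring

theorem gam_nonneg (i : Fin P) : 0 ≤ R.gam m θ r i := by
  rw [R.gam_eq h]
  linarith [reDot_sq_le (R.projected m θ r m i) (R.projected m θ r (pos N) i)]

theorem gam_eq_zero_iff (i : Fin P) : R.gam m θ r i = 0 ↔ ∃ s t : ℝ,
    s • R.projected m θ r m i + t • R.projected m θ r (pos N) i = 0 ∧ ¬(s = 0 ∧ t = 0) := by
  rw [R.gam_eq h, reDot_sq_eq_iff]

theorem gam_eq_zero_iff_not_linearIndependent (i : Fin P) : R.gam m θ r i = 0 ↔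
    ¬ LinearIndependent ℝ ![R.projected m θ r m i, R.projected m θ r (pos N) i] := by
  rw [R.gam_eq_zero_iff h, LinearIndependent.pair_iff]
  push Not
  rfl

/-- The constant part of the code contributes a multiple of the `i`-th column of `A`, which the
projection kills. -/
theorem projected_linear {a e : ℝ} (hm : ∀ k, m k = a * pos N k + e) (i : Fin P) :
    R.projected m θ r m i = a • R.projected m θ r (pos N) i := by
  have : R.weighted m θ r m i = (a : ℂ) • R.weighted m θ r (pos N) i +
      R.matA m θ r *ᵥ ((e : ℂ) • Pi.single i 1) := by
    funext k
    rw [Matrix.mulVec_smul, Matrix.mulVec_single_one]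
    simp only [weighted, Pi.add_apply, Pi.smul_apply, smul_eq_mul, matA, Matrix.col_apply,
      Matrix.of_apply]
    rw [hm k]
    push_cast
    ring
  rw [projected, projected, this, Matrix.mulVec_add, Matrix.mulVec_smul, projPerp_eq_perp,
    perp_mulVec_mulVec (R.matA_mulVec_injective h), add_zero]
  rfl

theorem gam_eq_zero_of_linear {a e : ℝ} (hm : ∀ k, m k = a * pos N k + e) (i : Fin P) :
    R.gam m θ r i = 0 := by
  rw [R.gam_eq_zero_iff h]
  refine ⟨1, -a, ?_, by simp⟩
  rw [R.projected_linear h hm]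
  simp

omit h in
theorem steer_ne_zero (m : Fin N → ℝ) (θ r : ℝ) (k : Fin N) : R.steer m θ r k ≠ 0 := by
  simp [steer, bD, bR, Complex.exp_ne_zero]

omit h in
theorem smul_projected_add (m : Fin N → ℝ) (θ r : Fin P → ℝ) (s t : ℝ) (i : Fin P) :
    s • R.projected m θ r m i + t • R.projected m θ r (pos N) i =
      R.projPerp m θ r *ᵥ (s • R.weighted m θ r m i + t • R.weighted m θ r (pos N) i) := by
  rw [Matrix.mulVec_add, Matrix.mulVec_smul, Matrix.mulVec_smul]
  rfl

/-- With one column in `A`, a relation between the projected vectors says that `(s m + t n) ⊙ b` is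
a multiple of `b`. As `b` has no zero entry, `s m + t n` is constant. -/
theorem gam_eq_zero_iff_of_single_target (hP : P = 1) (i : Fin P) :
    R.gam m θ r i = 0 ↔ ∃ a e : ℝ, ∀ k, m k = a * pos N k + e := by
  refine ⟨fun h0 => ?_, fun ⟨a, e, hm⟩ => R.gam_eq_zero_of_linear h hm i⟩
  obtain ⟨s, t, hst, hne⟩ := (R.gam_eq_zero_iff h i).1 h0
  subst hP
  rw [smul_projected_add] at hst
  obtain ⟨c, hc⟩ := exists_of_perp_mulVec_eq_zero hst
  have hk : ∀ k, s * m k + t * pos N k = (c i).re := by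
    intro k
    have h1 := congrFun hc k
    rw [matA_mulVec, Fintype.sum_subsingleton _ i] at h1
    have h2 : (((s * m k + t * pos N k : ℝ) : ℂ) - c i) * R.steer m (θ i) (r i) k = 0 := by
      simp only [Pi.add_apply, Pi.smul_apply, weighted, Complex.real_smul, smul_eq_mul] at h1
      push_cast
      linear_combination h1
    have h3 := (mul_eq_zero.1 h2).resolve_right (R.steer_ne_zero m _ _ k)
    rw [sub_eq_zero] at h3
    rw [← h3, Complex.ofReal_re]
  -- Here the positions themselves are constant, which forces at most one element, and then every
  -- code is constant.
  by_cases hs : s = 0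
  · have ht : t ≠ 0 := fun ht => hne ⟨hs, ht⟩
    rcases isEmpty_or_nonempty (Fin N) with hN | ⟨⟨k0⟩⟩
    · exact ⟨0, 0, fun k => hN.elim k⟩
    · refine ⟨0, m k0, fun k => ?_⟩
      have h1 := (hk k).trans (hk k0).symm
      simp only [hs, zero_mul, zero_add, mul_right_inj' ht, pos, sub_left_inj,
        Nat.cast_inj, Fin.val_inj] at h1
      simp [h1]
  · refine ⟨-t / s, (c i).re / s, fun k => ?_⟩
    rw [← hk k]
    field_simp
    ring

/-! ### The information matrix in terms of the projected vectors -/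

/-- The projected partial derivatives of the steering vector of target `i`,
up to a common unimodular factor. -/
def dir (m : Fin N → ℝ) (θ r : Fin P → ℝ) (i : Fin P) : Fin 2 → Fin N → ℂ :=
  ![(4 * Real.pi * R.fc * R.d * Real.cos (θ i) / R.c) • R.projected m θ r (pos N) i,
    (4 * Real.pi * R.Δf / R.c) • R.projected m θ r m i]

/-- The carrier phase contributes to the range derivative only a multiple of the steering vector
itself, so only the frequency increments survive projection. -/
theorem projPerp_mulVec_matD (q : LocIdx P) :
    R.projPerp m θ r *ᵥ (R.matD m θ r).col q = (-Complex.I) • R.dir m θ r q.1 q.2 := by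
  obtain ⟨i, a⟩ := q
  fin_cases a
  · have : (R.matD m θ r).col (i, 0) = (-Complex.I) •
        ((4 * Real.pi * R.fc * R.d * Real.cos (θ i) / R.c : ℝ) • R.weighted m θ r (pos N) i) := by
      funext k
      simp only [Matrix.col_apply, matD_direction, Pi.smul_apply, smul_eq_mul,
        Complex.real_smul]
      ring
    change R.projPerp m θ r *ᵥ (R.matD m θ r).col (i, 0) = _
    rw [this, Matrix.mulVec_smul, Matrix.mulVec_smul]
    rfl
  · have : (R.matD m θ r).col (i, 1) = R.matA m θ r *ᵥ
        ((-Complex.I * ((4 * Real.pi / R.c * R.fc : ℝ) : ℂ)) • Pi.single i 1) + (-Complex.I) •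
        ((4 * Real.pi * R.Δf / R.c : ℝ) • R.weighted m θ r m i) := by
      funext k
      rw [Matrix.mulVec_smul, Matrix.mulVec_single_one]
      simp only [Matrix.col_apply, matD_range, Pi.smul_apply, smul_eq_mul,
        Complex.real_smul, Pi.add_apply]
      ring
    change R.projPerp m θ r *ᵥ (R.matD m θ r).col (i, 1) = _
    rw [this, Matrix.mulVec_add, projPerp_eq_perp,
      perp_mulVec_mulVec (R.matA_mulVec_injective h), zero_add, Matrix.mulVec_smul,
      Matrix.mulVec_smul]
    rfl

theorem matC_apply (p q : LocIdx P) :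
    R.matC m θ r p q = star (R.dir m θ r p.1 p.2) ⬝ᵥ R.dir m θ r q.1 q.2 := by
  have h1 : R.matC m θ r p q = star ((R.matD m θ r).col p) ⬝ᵥ
      (R.projPerp m θ r *ᵥ (R.matD m θ r).col q) := by
    rw [matC, Matrix.mul_assoc, Matrix.mul_apply]
    rfl
  rw [h1, ← R.star_projected_dotProduct h, R.projPerp_mulVec_matD h, R.projPerp_mulVec_matD h,
    star_smul, smul_dotProduct, dotProduct_smul, smul_smul]
  simp

end LinearlyIndependent

/-! ### Block diagonal information matrices -/

/-- `J` is block diagonal, and the block of target `i` is `κ i` times the real Gram matrix of the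
projected derivatives. -/
structure IsBlockInfo (m : Fin N → ℝ) (θ r : Fin P → ℝ) (κ : Fin P → ℝ)
    (J : Matrix (LocIdx P) (LocIdx P) ℝ) : Prop where
  pos : ∀ i, 0 < κ i
  off : ∀ i j a b, i ≠ j → J (i, a) (j, b) = 0
  diag : ∀ i a b, J (i, a) (i, b) = κ i * reDot (R.dir m θ r i a) (R.dir m θ r i b)

/-- Serves both the exact information matrix, with the sample covariance, and its limit, with the
limiting powers. -/
theorem isBlockInfo_smul_infoMat {m : Fin N → ℝ} {θ r : Fin P → ℝ}
    (h : LinearIndependent ℂ fun i => R.steer m (θ i) (r i)) {T : Matrix (Fin P) (Fin P) ℂ}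
    {t : Fin P → ℝ} {c : ℝ} (hc : ∀ i, 0 < c * t i) (hT : ∀ i j, i ≠ j → T i j = 0)
    (hT' : ∀ i, T i i = t i) :
    R.IsBlockInfo m θ r (fun i => c * t i) (c • R.infoMat m θ r T) where
  pos := hc
  off i j a b hij := by simp [infoMat_apply, hT j i hij.symm]
  diag i a b := by
    rw [Matrix.smul_apply, infoMat_apply, hT', R.matC_apply h, mul_comm (_ ⬝ᵥ _),
      Complex.re_ofReal_mul, smul_eq_mul, reDot, mul_assoc]

theorem mulVec_of_blockDiagonal {J : Matrix (LocIdx P) (LocIdx P) ℝ}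
    (hJ : ∀ i j a b, i ≠ j → J (i, a) (j, b) = 0) (w : LocIdx P → ℝ) (i : Fin P) (a : Fin 2) :
    (J *ᵥ w) (i, a) = ∑ b, J (i, a) (i, b) * w (i, b) := by
  rw [Matrix.mulVec, dotProduct, Fintype.sum_prod_type, Finset.sum_eq_single i]
  · intro j _ hj
    exact Finset.sum_eq_zero fun b _ => by rw [hJ _ _ _ _ hj.symm, zero_mul]
  · simp

theorem det_of_blockDiagonal {J : Matrix (LocIdx P) (LocIdx P) ℝ}
    (hJ : ∀ i j a b, i ≠ j → J (i, a) (j, b) = 0) : J.det = ∏ i, (block J i).det := by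
  -- `Matrix.blockDiagonal` has the block label as second index, hence the swap.
  rw [← Matrix.det_blockDiagonal, ← Matrix.det_submatrix_equiv_self (Equiv.prodComm (Fin 2) _) J]
  congr 1
  ext ⟨a, i⟩ ⟨b, j⟩
  rw [Matrix.blockDiagonal_apply]
  split_ifs with hij
  · simp only at hij
    subst hij
    rfl
  · exact hJ _ _ _ _ hij

theorem inv_of_blockDiagonal {J : Matrix (LocIdx P) (LocIdx P) ℝ}
    (hJ : ∀ i j a b, i ≠ j → J (i, a) (j, b) = 0) (hdet : ∀ i, IsUnit (block J i).det)
    (i j : Fin P) (a b : Fin 2) :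
    J⁻¹ (i, a) (j, b) = if i = j then (block J i)⁻¹ a b else 0 := by
  have : J⁻¹ = Matrix.of fun p q : LocIdx P =>
      if p.1 = q.1 then (block J p.1)⁻¹ p.2 q.2 else 0 := by
    refine Matrix.inv_eq_right_inv ?_
    ext ⟨i, a⟩ ⟨j, b⟩
    change (J *ᵥ fun p => if p.1 = j then (block J p.1)⁻¹ p.2 b else 0) (i, a) = _
    rw [mulVec_of_blockDiagonal hJ]
    by_cases hij : i = j
    · subst hij
      have h1 := congrFun (congrFun (Matrix.mul_nonsing_inv _ (hdet i)) a) b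
      simpa [Matrix.mul_apply, Matrix.one_apply, block] using h1
    · simp [hij]
  rw [this]
  rfl

section IsBlockInfo

variable {R} {m : Fin N → ℝ} {θ r : Fin P → ℝ} {κ : Fin P → ℝ}
  {J : Matrix (LocIdx P) (LocIdx P) ℝ}

/-- A real relation between the vectors of a Gram matrix is a null vector of that matrix. -/
theorem IsBlockInfo.mulVec_eq_zero (hJ : R.IsBlockInfo m θ r κ J) {i : Fin P} {u : LocIdx P → ℝ}
    (hu : ∀ j a, j ≠ i → u (j, a) = 0)
    (h0 : ∑ b, u (i, b) • R.dir m θ r i b = 0) : J *ᵥ u = 0 := by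
  funext ⟨j, a⟩
  rw [mulVec_of_blockDiagonal hJ.off]
  by_cases hj : j = i
  · subst hj
    have : reDot (R.dir m θ r j a) (∑ b, u (j, b) • R.dir m θ r j b) = 0 := by
      rw [h0]; simp [reDot]
    rw [Fin.sum_univ_two, reDot_add_right, reDot_smul_right, reDot_smul_right] at this
    rw [Fin.sum_univ_two, hJ.diag, hJ.diag, Pi.zero_apply]
    linear_combination κ j * this
  · simp [hu j _ hj]

end IsBlockInfo

end FDA

end

/-! ### Cramér–Rao bounds of block diagonal information matrices -/

noncomputable section

namespace FDA

variable {R : FDA} {N P L : ℕ} {m : Fin N → ℝ} {θ r : Fin P → ℝ} {κ : Fin P → ℝ}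
  {J : Matrix (LocIdx P) (LocIdx P) ℝ}

namespace IsBlockInfo

theorem apply_zero_zero (hJ : R.IsBlockInfo m θ r κ J) (i : Fin P) : J (i, 0) (i, 0) =
    κ i * (4 * Real.pi * R.fc * R.d * Real.cos (θ i) / R.c) ^ 2 *
      reDot (R.projected m θ r (FDA.pos N) i) (R.projected m θ r (FDA.pos N) i) := by
  rw [hJ.diag]
  simp only [dir, Matrix.cons_val_zero, reDot_smul_left, reDot_smul_right]
  ring

theorem apply_zero_one (hJ : R.IsBlockInfo m θ r κ J) (i : Fin P) : J (i, 0) (i, 1) =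
    κ i * (4 * Real.pi * R.fc * R.d * Real.cos (θ i) / R.c) * (4 * Real.pi * R.Δf / R.c) *
      reDot (R.projected m θ r m i) (R.projected m θ r (FDA.pos N) i) := by
  rw [hJ.diag]
  simp only [dir, Matrix.cons_val_zero, Matrix.cons_val_one, reDot_smul_left, reDot_smul_right,
    reDot_comm (R.projected m θ r (FDA.pos N) i)]
  ring

theorem apply_one_zero (hJ : R.IsBlockInfo m θ r κ J) (i : Fin P) : J (i, 1) (i, 0) =
    κ i * (4 * Real.pi * R.fc * R.d * Real.cos (θ i) / R.c) * (4 * Real.pi * R.Δf / R.c) *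
      reDot (R.projected m θ r m i) (R.projected m θ r (FDA.pos N) i) := by
  rw [← hJ.apply_zero_one, hJ.diag, hJ.diag, reDot_comm]

theorem apply_one_one (hJ : R.IsBlockInfo m θ r κ J) (i : Fin P) : J (i, 1) (i, 1) =
    κ i * (4 * Real.pi * R.Δf / R.c) ^ 2 *
      reDot (R.projected m θ r m i) (R.projected m θ r m i) := by
  rw [hJ.diag]
  simp only [dir, Matrix.cons_val_one, Matrix.cons_val_fin_one, reDot_smul_left, reDot_smul_right]
  ring

theorem det_block (hJ : R.IsBlockInfo m θ r κ J)
    (h : LinearIndependent ℂ fun i => R.steer m (θ i) (r i)) (i : Fin P) :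
    (block J i).det = (κ i * (4 * Real.pi * R.fc * R.d * Real.cos (θ i) / R.c) *
      (4 * Real.pi * R.Δf / R.c)) ^ 2 * R.gam m θ r i := by
  rw [Matrix.det_fin_two, R.gam_eq h]
  simp only [block, Matrix.submatrix_apply, hJ.apply_zero_zero, hJ.apply_zero_one,
    hJ.apply_one_zero, hJ.apply_one_one]
  ring

theorem isUnit_det_block (hJ : R.IsBlockInfo m θ r κ J)
    (h : LinearIndependent ℂ fun i => R.steer m (θ i) (r i)) (hθ : ∀ i, Real.cos (θ i) ≠ 0)
    (i : Fin P) : IsUnit (block J i).det ↔ 0 < R.gam m θ r i := by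
  have h1 := hJ.pos i
  have h2 := R.fc_pos
  have h3 := R.d_pos
  have h4 := R.Δf_pos
  have h5 := R.c_pos
  have h6 := hθ i
  have hne : (κ i * (4 * Real.pi * R.fc * R.d * Real.cos (θ i) / R.c) *
      (4 * Real.pi * R.Δf / R.c)) ^ 2 ≠ 0 := by positivity
  rw [hJ.det_block h, isUnit_iff_ne_zero, mul_ne_zero_iff_left hne,
    (R.gam_nonneg h i).lt_iff_ne']

theorem isUnit_det (hJ : R.IsBlockInfo m θ r κ J)
    (h : LinearIndependent ℂ fun i => R.steer m (θ i) (r i)) (hθ : ∀ i, Real.cos (θ i) ≠ 0) :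
    IsUnit J.det ↔ ∀ i, 0 < R.gam m θ r i := by
  rw [det_of_blockDiagonal hJ.off, isUnit_iff_ne_zero, Finset.prod_ne_zero_iff]
  simp only [Finset.mem_univ, forall_true_left, ← isUnit_iff_ne_zero, hJ.isUnit_det_block h hθ]

/-- The columns of the inverse of block `i`, by Cramer's rule, extended by zero. Only this block has
to be invertible. -/
theorem exists_mulVec_eq_single (hJ : R.IsBlockInfo m θ r κ J)
    (h : LinearIndependent ℂ fun i => R.steer m (θ i) (r i)) (hθ : ∀ i, Real.cos (θ i) ≠ 0)
    {i : Fin P} (hi : 0 < R.gam m θ r i) :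
    (∃ w, J *ᵥ w = Pi.single (i, 0) 1 ∧ w (i, 0) =
      sqNorm (R.projected m θ r m i) /
        (κ i * (4 * Real.pi * R.fc * R.d * Real.cos (θ i) / R.c) ^ 2 * R.gam m θ r i)) ∧
    (∃ w, J *ᵥ w = Pi.single (i, 1) 1 ∧ w (i, 1) =
      sqNorm (R.projected m θ r (FDA.pos N) i) /
        (κ i * (4 * Real.pi * R.Δf / R.c) ^ 2 * R.gam m θ r i)) := by
  have h1 := (hJ.pos i).ne'
  have h2 := R.fc_pos
  have h3 := R.d_pos
  have h4 := R.Δf_pos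
  have h5 := R.c_pos
  have h6 := hθ i
  have ha : 4 * Real.pi * R.fc * R.d * Real.cos (θ i) / R.c ≠ 0 := by positivity
  have hb : 4 * Real.pi * R.Δf / R.c ≠ 0 := by positivity
  have hg := R.gam_eq h i
  have e00 := hJ.apply_zero_zero i
  have e01 := hJ.apply_zero_one i
  have e10 := hJ.apply_one_zero i
  have e11 := hJ.apply_one_one i
  rw [sqNorm_eq_reDot, sqNorm_eq_reDot]
  set a := 4 * Real.pi * R.fc * R.d * Real.cos (θ i) / R.c
  set b := 4 * Real.pi * R.Δf / R.c
  set X := reDot (R.projected m θ r m i) (R.projected m θ r m i)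
  set Y := reDot (R.projected m θ r (FDA.pos N) i) (R.projected m θ r (FDA.pos N) i)
  set Z := reDot (R.projected m θ r m i) (R.projected m θ r (FDA.pos N) i)
  have hg' := hi.ne'
  refine ⟨⟨fun q => if q.1 = i then ![X / (κ i * a ^ 2 * R.gam m θ r i),
      -Z / (κ i * a * b * R.gam m θ r i)] q.2 else 0, ?_, by simp⟩,
    ⟨fun q => if q.1 = i then ![-Z / (κ i * a * b * R.gam m θ r i),
      Y / (κ i * b ^ 2 * R.gam m θ r i)] q.2 else 0, ?_, by simp⟩⟩
  all_goals
    funext ⟨j, k⟩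
    rw [mulVec_of_blockDiagonal hJ.off]
    by_cases hj : j = i
    · subst hj
      fin_cases k
      · simp [Fin.sum_univ_two, e00, e01]
        field_simp
        first | ring1 | (rw [hg]; ring1)
      · simp [Fin.sum_univ_two, e10, e11]
        field_simp
        first | ring1 | (rw [hg]; ring1)
    · simp [hj]

theorem crb_eq (hJ : R.IsBlockInfo m θ r κ J) (hs : J.IsSymm) (hp : ∀ u, 0 ≤ u ⬝ᵥ (J *ᵥ u))
    (h : LinearIndependent ℂ fun i => R.steer m (θ i) (r i)) (hθ : ∀ i, Real.cos (θ i) ≠ 0)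
    {i : Fin P} (hi : 0 < R.gam m θ r i) :
    crb J (i, 0) = ENNReal.ofReal (sqNorm (R.projected m θ r m i) /
        (κ i * (4 * Real.pi * R.fc * R.d * Real.cos (θ i) / R.c) ^ 2 * R.gam m θ r i)) ∧
    crb J (i, 1) = ENNReal.ofReal (sqNorm (R.projected m θ r (FDA.pos N) i) /
        (κ i * (4 * Real.pi * R.Δf / R.c) ^ 2 * R.gam m θ r i)) := by
  obtain ⟨⟨w, hw, hw'⟩, ⟨v, hv, hv'⟩⟩ := hJ.exists_mulVec_eq_single h hθ hi
  rw [crb_eq_of_mulVec_eq_single hs hp hw, crb_eq_of_mulVec_eq_single hs hp hv, hw', hv']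
  exact ⟨rfl, rfl⟩

theorem crb_eq_top_of_dependent (hJ : R.IsBlockInfo m θ r κ J)
    (hθ : ∀ i, Real.cos (θ i) ≠ 0) {i : Fin P} {s t : ℝ}
    (hst : s • R.projected m θ r m i + t • R.projected m θ r (FDA.pos N) i = 0) :
    (t ≠ 0 → crb J (i, 0) = ⊤) ∧ (s ≠ 0 → crb J (i, 1) = ⊤) := by
  have h2 := R.fc_pos
  have h3 := R.d_pos
  have h4 := R.Δf_pos
  have h5 := R.c_pos
  have h6 := hθ i
  have ha : 4 * Real.pi * R.fc * R.d * Real.cos (θ i) / R.c ≠ 0 := by positivity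
  have hb : 4 * Real.pi * R.Δf / R.c ≠ 0 := by positivity
  -- Dividing by the derivative scale factors turns the relation `s, t` into a relation between the
  -- vectors `dir`.
  set u : LocIdx P → ℝ := fun q => if q.1 = i then
    ![t / (4 * Real.pi * R.fc * R.d * Real.cos (θ i) / R.c), s / (4 * Real.pi * R.Δf / R.c)] q.2
    else 0 with hu
  have h0 : J *ᵥ u = 0 := by
    refine hJ.mulVec_eq_zero (i := i) (fun j a hj => by simp [hu, hj]) ?_
    simp only [hu, if_true, Fin.sum_univ_two, dir, Matrix.cons_val_zero, Matrix.cons_val_one,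
      smul_smul, div_mul_cancel₀ _ ha, div_mul_cancel₀ _ hb]
    rw [add_comm, hst]
  have h0' : u ⬝ᵥ (J *ᵥ u) = 0 := by rw [h0, dotProduct_zero]
  constructor
  · intro ht
    exact crb_eq_top (u := u) (by simpa [hu] using div_ne_zero ht ha) h0'
  · intro hs
    exact crb_eq_top (u := u) (by simpa [hu] using div_ne_zero hs hb) h0'

theorem crb_eq_top_of_projected_ne_zero (hJ : R.IsBlockInfo m θ r κ J)
    (h : LinearIndependent ℂ fun i => R.steer m (θ i) (r i)) (hθ : ∀ i, Real.cos (θ i) ≠ 0)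
    {i : Fin P} (hi : R.gam m θ r i = 0) :
    (R.projected m θ r m i ≠ 0 → crb J (i, 0) = ⊤) ∧
      (R.projected m θ r (FDA.pos N) i ≠ 0 → crb J (i, 1) = ⊤) := by
  obtain ⟨s, t, hst, hne⟩ := (R.gam_eq_zero_iff h i).1 hi
  have H := hJ.crb_eq_top_of_dependent hθ hst
  refine ⟨fun hx => H.1 fun ht => hne ⟨?_, ht⟩, fun hy => H.2 fun hs => hne ⟨hs, ?_⟩⟩
  · simpa [ht, hx] using hst
  · simpa [hs, hy] using hst

theorem gam_eq_zero_iff_crb_eq_top (hJ : R.IsBlockInfo m θ r κ J) (hs : J.IsSymm)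
    (hp : ∀ u, 0 ≤ u ⬝ᵥ (J *ᵥ u))
    (h : LinearIndependent ℂ fun i => R.steer m (θ i) (r i)) (hθ : ∀ i, Real.cos (θ i) ≠ 0)
    (i : Fin P) : R.gam m θ r i = 0 ↔ crb J (i, 0) = ⊤ ∨ crb J (i, 1) = ⊤ := by
  constructor
  · intro hi
    obtain ⟨s, t, hst, hne⟩ := (R.gam_eq_zero_iff h i).1 hi
    have H := hJ.crb_eq_top_of_dependent hθ hst
    by_cases ht : t = 0
    · exact Or.inr (H.2 fun hs0 => hne ⟨hs0, ht⟩)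
    · exact Or.inl (H.1 ht)
  · intro htop
    by_contra hne
    have H := hJ.crb_eq hs hp h hθ ((R.gam_nonneg h i).lt_of_ne' hne)
    rw [H.1, H.2] at htop
    simp at htop

theorem crb_eq_top_of_linear (hJ : R.IsBlockInfo m θ r κ J)
    (h : LinearIndependent ℂ fun i => R.steer m (θ i) (r i)) (hθ : ∀ i, Real.cos (θ i) ≠ 0)
    {a e : ℝ} (ha : a ≠ 0) (hm : ∀ k, m k = a * FDA.pos N k + e) (i : Fin P) :
    crb J (i, 0) = ⊤ ∧ crb J (i, 1) = ⊤ := by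
  have H := hJ.crb_eq_top_of_dependent hθ (i := i) (s := 1) (t := -a)
    (by rw [R.projected_linear h hm]; simp)
  exact ⟨H.1 (neg_ne_zero.2 ha), H.2 one_ne_zero⟩

end IsBlockInfo

/-! ### Uncorrelated amplitudes -/

theorem sampleCov_self (α : Fin L → Fin P → ℂ) (i : Fin P) :
    sampleCov α i i = ((1 / (L : ℝ) * ∑ l, ‖α l i‖ ^ 2 : ℝ) : ℂ) := by
  simp only [sampleCov, Matrix.of_apply, Complex.star_def, Complex.mul_conj, Complex.sq_norm]
  push_cast
  rfl

theorem ofReal_re_sampleCov (α : Fin L → Fin P → ℂ) (i : Fin P) :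
    ((sampleCov α i i).re : ℂ) = sampleCov α i i := by
  rw [sampleCov_self, Complex.ofReal_re]

theorem sampleCov_pos {α : Fin L → Fin P → ℂ} {i : Fin P} (h : sampleCov α i i ≠ 0) :
    0 < L ∧ 0 < (sampleCov α i i).re := by
  constructor
  · rcases Nat.eq_zero_or_pos L with rfl | hL
    · exact absurd (by simp [sampleCov]) h
    · exact hL
  · rw [sampleCov_self] at h ⊢
    rw [Complex.ofReal_re]
    exact lt_of_le_of_ne (by positivity) fun h0 => h (by rw [← h0, Complex.ofReal_zero])

theorem isBlockInfo_fimLoc (h : LinearIndependent ℂ fun i => R.steer m (θ i) (r i))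
    {α : Fin L → Fin P → ℂ} (h0 : ∀ i j, i ≠ j → sampleCov α i j = 0)
    (h1 : ∀ i, sampleCov α i i ≠ 0) :
    R.IsBlockInfo m θ r (fun i => 2 * (L : ℝ) / R.σ ^ 2 * (sampleCov α i i).re)
      (R.fimLoc m θ r α) := by
  rw [R.fimLoc_eq h]
  refine R.isBlockInfo_smul_infoMat h (fun i => ?_) h0 fun i => (ofReal_re_sampleCov α i).symm
  obtain ⟨hL, hS⟩ := sampleCov_pos (h1 i)
  have := R.σ_pos
  positivity

/-! ### Amplitudes that are uncorrelated in the limit -/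

/-- Inversion is continuous at the invertible limit `K`, so `J L` is eventually invertible and `L •
(J L)⁻¹ = (J L / L)⁻¹` converges. Finite-sample matrices need not be block diagonal. -/
theorem tendsto_mul_crb {ι : Type*} [Fintype ι] [DecidableEq ι] {J : ℕ → Matrix ι ι ℝ}
    {K : Matrix ι ι ℝ} (hs : ∀ L, (J L).IsSymm) (hp : ∀ L u, 0 ≤ u ⬝ᵥ (J L *ᵥ u))
    (hK : ∀ p q, Filter.Tendsto (fun L : ℕ => (1 / (L : ℝ)) * J L p q) Filter.atTop (𝓝 (K p q)))
    (hdet : IsUnit K.det) {q : ι} {w : ι → ℝ} (hw : K *ᵥ w = Pi.single q 1) :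
    Filter.Tendsto (fun L : ℕ => (L : ℝ≥0∞) * crb (J L) q) Filter.atTop
      (𝓝 (ENNReal.ofReal (w q))) := by
  have hKt : Filter.Tendsto (fun L : ℕ => (1 / (L : ℝ)) • J L) Filter.atTop (𝓝 K) :=
    tendsto_pi_nhds.2 fun p => tendsto_pi_nhds.2 fun q => hK p q
  have hdt : Filter.Tendsto (fun L : ℕ => ((1 / (L : ℝ)) • J L).det) Filter.atTop (𝓝 K.det) :=
    (Continuous.matrix_det continuous_id).continuousAt.tendsto.comp hKt
  have hat : Filter.Tendsto (fun L : ℕ => ((1 / (L : ℝ)) • J L).adjugate) Filter.atTop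
      (𝓝 K.adjugate) :=
    (Continuous.matrix_adjugate continuous_id).continuousAt.tendsto.comp hKt
  have hinv : Filter.Tendsto (fun L : ℕ => ((1 / (L : ℝ)) • J L)⁻¹ q q) Filter.atTop
      (𝓝 (K⁻¹ q q)) := by
    simp only [Matrix.inv_def, Ring.inverse_eq_inv', Matrix.smul_apply, smul_eq_mul]
    exact (hdt.inv₀ hdet.ne_zero).mul ((tendsto_pi_nhds.1 (tendsto_pi_nhds.1 hat q)) q)
  have hwq : K⁻¹ q q = w q := by
    have : w = K⁻¹ *ᵥ Pi.single q 1 := by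
      rw [← hw, Matrix.mulVec_mulVec, Matrix.nonsing_inv_mul _ hdet, Matrix.one_mulVec]
    rw [this]
    simp
  rw [← hwq]
  refine ((ENNReal.continuous_ofReal.tendsto _).comp hinv).congr' ?_
  filter_upwards [hdt.eventually_ne hdet.ne_zero, Filter.eventually_gt_atTop 0] with L hL hL0
  have hLr : (L : ℝ) ≠ 0 := by positivity
  have hJ : J L = (L : ℝ) • ((1 / (L : ℝ)) • J L) := by
    rw [smul_smul, mul_one_div_cancel hLr, one_smul]
  have hJdet : IsUnit (J L).det := by
    rw [hJ, Matrix.det_smul]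
    exact ((pow_ne_zero _ hLr).isUnit).mul hL.isUnit
  rw [crb_eq_inv (hs L) (hp L) hJdet, ← ENNReal.ofReal_natCast, ← ENNReal.ofReal_mul (by positivity),
    Function.comp]
  congr 1
  have : ((1 / (L : ℝ)) • J L)⁻¹ = (L : ℝ) • (J L)⁻¹ := by
    refine Matrix.inv_eq_right_inv ?_
    rw [Matrix.smul_mul, Matrix.mul_smul, smul_smul, Matrix.mul_nonsing_inv _ hJdet,
      one_div_mul_cancel hLr, one_smul]
  rw [this]
  rfl

theorem tendsto_fimLoc (h : LinearIndependent ℂ fun i => R.steer m (θ i) (r i))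
    {α : ℕ → Fin P → ℂ} {T : Matrix (Fin P) (Fin P) ℂ}
    (hT : ∀ i j, Filter.Tendsto
      (fun L : ℕ => sampleCov (fun l : Fin L => α l) i j) Filter.atTop (𝓝 (T i j)))
    (p q : LocIdx P) : Filter.Tendsto
      (fun L : ℕ => (1 / (L : ℝ)) * R.fimLoc m θ r (fun l : Fin L => α l) p q)
      Filter.atTop (𝓝 (((2 / R.σ ^ 2) • R.infoMat m θ r T) p q)) := by
  have hσ := R.σ_pos
  have h1 : Filter.Tendsto (fun L : ℕ => 2 / R.σ ^ 2 * (R.matC m θ r p q *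
      sampleCov (fun l : Fin L => α l) q.1 p.1).re) Filter.atTop
      (𝓝 (((2 / R.σ ^ 2) • R.infoMat m θ r T) p q)) := by
    rw [Matrix.smul_apply, infoMat_apply, smul_eq_mul]
    exact ((Complex.continuous_re.tendsto _).comp ((hT q.1 p.1).const_mul _)).const_mul _
  refine h1.congr' ?_
  filter_upwards [Filter.eventually_gt_atTop 0] with L hL
  have hLr : (L : ℝ) ≠ 0 := by positivity
  rw [R.fimLoc_eq h, Matrix.smul_apply, infoMat_apply, smul_eq_mul]
  field_simp

end FDA

end

noncomputable section
open MeasureTheory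

/-! ### Zero sets of analytic functions under products of laws without atoms -/

/-- The zeros form a discrete subset of the line, hence a countable one, and a law without atoms
ignores countable sets. -/
theorem AnalyticOnNhd.ae_ne_zero {f : ℝ → ℂ} (hf : AnalyticOnNhd ℝ f Set.univ) {x : ℝ}
    (hx : f x ≠ 0) (g : Measure ℝ) [NullSingletonClass g] : ∀ᵐ t ∂g, f t ≠ 0 := by
  have h1 := hf.preimage_zero_mem_codiscrete hx
  rw [Set.preimage_compl, compl_mem_codiscrete_iff] at h1
  have h2 : (f ⁻¹' {0}).Countable :=
    (HereditarilyLindelofSpace.isLindelof _).countable_of_isDiscrete h1.2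
  exact h2.ae_notMem g

/-- Induction with Fubini: for almost every first coordinate, the slice is still nonzero at the tail
of the witness `x`, so the induction hypothesis applies to it. -/
theorem AnalyticOnNhd.ae_pi_ne_zero {n : ℕ} {F : (Fin n → ℝ) → ℂ}
    (hF : AnalyticOnNhd ℝ F Set.univ) {x : Fin n → ℝ} (hx : F x ≠ 0)
    (g : Measure ℝ) [IsProbabilityMeasure g] [NullSingletonClass g] :
    ∀ᵐ m ∂(Measure.pi fun _ : Fin n => g), F m ≠ 0 := by
  induction n with
  | zero => exact Filter.Eventually.of_forall fun m => Subsingleton.elim x m ▸ hx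
  | succ n ih =>
    have mp := measurePreserving_piFinSuccAbove (fun _ : Fin (n + 1) => g) 0
    have hcons : ∀ y : Fin (n + 1) → ℝ, Fin.cons (y 0) (Fin.tail y) = y := Fin.cons_self_tail
    have hcont : Continuous F := continuous_iff_continuousAt.2 fun y =>
      (hF y (Set.mem_univ _)).continuousAt
    have hc : ∀ y : ℝ × (Fin n → ℝ), AnalyticAt ℝ
        (fun p : ℝ × (Fin n → ℝ) => (Fin.cons p.1 p.2 : Fin (n + 1) → ℝ)) y := by
      intro y
      rw [analyticAt_pi_iff]
      intro i
      refine Fin.cases ?_ (fun j => ?_) i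
      · simpa using analyticAt_fst
      · simp only [Fin.cons_succ]
        exact ((ContinuousLinearMap.proj j : (Fin n → ℝ) →L[ℝ] ℝ).comp
          (ContinuousLinearMap.snd ℝ ℝ (Fin n → ℝ))).analyticAt y
    have hFc : ∀ y : ℝ × (Fin n → ℝ), AnalyticAt ℝ
        (fun p : ℝ × (Fin n → ℝ) => F (Fin.cons p.1 p.2)) y := fun y =>
      (hF _ (Set.mem_univ _)).comp (hc y)
    have h1 : ∀ᵐ t ∂g, F (Fin.cons t (Fin.tail x)) ≠ 0 := by
      refine AnalyticOnNhd.ae_ne_zero (f := fun t => F (Fin.cons t (Fin.tail x))) (x := x 0)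
        (fun t _ => ?_) (by rwa [hcons]) g
      exact (hFc (t, Fin.tail x)).comp (f := fun t : ℝ => (t, Fin.tail x))
        (analyticAt_id.prod analyticAt_const)
    have h2 : ∀ᵐ t ∂g, ∀ᵐ y ∂(Measure.pi fun _ : Fin n => g), F (Fin.cons t y) ≠ 0 := by
      filter_upwards [h1] with t ht
      refine ih (F := fun y => F (Fin.cons t y)) (fun y _ => ?_) ht
      exact (hFc (t, y)).comp (f := fun y : Fin n → ℝ => (t, y))
        (analyticAt_const.prod analyticAt_id)
    have hmeas : MeasurableSet {p : ℝ × (Fin n → ℝ) | F (Fin.cons p.1 p.2) ≠ 0} := by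
      refine (IsOpen.measurableSet ?_)
      refine isOpen_ne_fun ?_ continuous_const
      exact continuous_iff_continuousAt.2 fun y => (hFc y).continuousAt
    have h3 := (Measure.ae_prod_mem_iff_ae_ae_mem (μ := g)
      (ν := Measure.pi fun _ : Fin n => g) hmeas).2 h2
    have h4 := mp.quasiMeasurePreserving.ae h3
    filter_upwards [h4] with m hm
    have : F (Fin.cons (m 0) (Fin.tail m)) ≠ 0 := hm
    rwa [hcons] at this

/-! ### A confluent Vandermonde system -/

/-- The equations say that `p ↦ ∑ v_j p(w_j) + y w_i p'(w_i)` vanishes on polynomials of degree at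
most `P`. Testing on `∏ (X - w_j)`, whose roots are simple, gives `y = 0`; an ordinary Vandermonde
system remains. -/
theorem confluent_vandermonde {P : ℕ} {w v : Fin P → ℂ} (hw : Function.Injective w) {i : Fin P}
    (hi : w i ≠ 0) {y : ℂ}
    (h : ∀ k : ℕ, k ≤ P → ∑ j, v j * w j ^ k + y * (k * w i ^ k) = 0) : v = 0 ∧ y = 0 := by
  have hpoly : ∀ p : Polynomial ℂ, p.natDegree ≤ P →
      ∑ j, v j * p.eval (w j) + y * (w i * p.derivative.eval (w i)) = 0 := by
    intro p hp
    have e1 : ∀ x : ℂ, p.eval x = ∑ k ∈ Finset.range (P + 1), p.coeff k * x ^ k := fun x =>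
      Polynomial.eval_eq_sum_range' (Nat.lt_succ_of_le hp) x
    have e2 : ∀ x : ℂ, x * p.derivative.eval x =
        ∑ k ∈ Finset.range (P + 1), p.coeff k * (k * x ^ k) := by
      intro x
      conv_lhs => rw [Polynomial.as_sum_range' p (P + 1) (Nat.lt_succ_of_le hp)]
      rw [Polynomial.derivative_sum, Polynomial.eval_finsetSum, Finset.mul_sum]
      refine Finset.sum_congr rfl fun k _ => ?_
      rw [Polynomial.derivative_monomial, Polynomial.eval_monomial]
      rcases k with _ | k
      · simp
      · rw [Nat.add_sub_cancel, pow_succ]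
        ring
    simp only [e1, e2, Finset.mul_sum]
    rw [Finset.sum_comm, ← Finset.sum_add_distrib]
    refine Finset.sum_eq_zero fun k hk => ?_
    have := h k (Nat.lt_succ_iff.1 (Finset.mem_range.1 hk))
    rw [← mul_zero (p.coeff k), ← this, mul_add, Finset.mul_sum]
    congr 1
    · exact Finset.sum_congr rfl fun j _ => by ring
    · ring
  have hy : y = 0 := by
    set p : Polynomial ℂ := ∏ j, (Polynomial.X - Polynomial.C (w j)) with hp
    have hroot : ∀ j, p.eval (w j) = 0 := by
      intro j
      rw [hp, Polynomial.eval_prod]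
      exact Finset.prod_eq_zero (Finset.mem_univ j) (by simp)
    have hdeg : p.natDegree ≤ P := by
      rw [hp, Polynomial.natDegree_finsetProd_X_sub_C_eq_card]
      simp
    have hsep : p.Separable := Polynomial.separable_prod_X_sub_C_iff.2 hw
    have hder : p.derivative.eval (w i) ≠ 0 := by
      have := hsep.eval₂_derivative_ne_zero (RingHom.id ℂ) (x := w i)
        (by simpa [Polynomial.eval₂_id] using hroot i)
      simpa [Polynomial.eval₂_id] using this
    have := hpoly p hdeg
    simp only [hroot, mul_zero, Finset.sum_const_zero, zero_add, mul_eq_zero, hi, hder,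
      or_false] at this
    exact this
  refine ⟨Matrix.eq_zero_of_forall_pow_sum_mul_pow_eq_zero hw fun k => ?_, hy⟩
  simpa [hy] using h k k.2.le

namespace FDA

variable (R : FDA) {N P L : ℕ}

/-! ### Random frequency codes -/

/-- The steering vectors of all targets and the two weighted steering vectors of target `i`. -/
def augmented (m : Fin N → ℝ) (θ r : Fin P → ℝ) (i : Fin P) : Matrix (Fin N) (Fin P ⊕ Fin 2) ℂ :=
  Matrix.of fun k => Sum.elim (fun j => R.steer m (θ j) (r j) k)
    ![R.weighted m θ r m i k, R.weighted m θ r (pos N) i k]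

theorem augmented_mulVec (m : Fin N → ℝ) (θ r : Fin P → ℝ) (i : Fin P) (v : Fin P ⊕ Fin 2 → ℂ) :
    R.augmented m θ r i *ᵥ v = R.matA m θ r *ᵥ (fun j => v (Sum.inl j)) +
      v (Sum.inr 0) • R.weighted m θ r m i + v (Sum.inr 1) • R.weighted m θ r (pos N) i := by
  funext k
  simp only [augmented, Matrix.mulVec, dotProduct, Fintype.sum_sum_type, Fin.sum_univ_two,
    Matrix.of_apply, Sum.elim_inl, Sum.elim_inr, Matrix.cons_val_zero, Matrix.cons_val_one,
    Pi.add_apply, Pi.smul_apply, smul_eq_mul, matA]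
  ring

theorem linearIndependent_of_augmented_injective {m : Fin N → ℝ} {θ r : Fin P → ℝ} {i : Fin P}
    (h : Function.Injective (R.augmented m θ r i).mulVec) :
    LinearIndependent ℂ fun j => R.steer m (θ j) (r j) := by
  rw [Fintype.linearIndependent_iff]
  intro c hc j
  have : R.augmented m θ r i *ᵥ (Sum.elim c 0) = R.augmented m θ r i *ᵥ 0 := by
    rw [augmented_mulVec, Matrix.mulVec_zero, matA_mulVec]
    simpa using hc
  exact congrFun (h this) (Sum.inl j)

/-- A relation between the projected vectors lifts, modulo the columns of `A`, to a relation between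
the columns of the augmented matrix. -/
theorem gam_pos_of_augmented_injective {m : Fin N → ℝ} {θ r : Fin P → ℝ} {i : Fin P}
    (h : Function.Injective (R.augmented m θ r i).mulVec) : 0 < R.gam m θ r i := by
  have hA := R.linearIndependent_of_augmented_injective h
  refine (R.gam_nonneg hA i).lt_of_ne' fun h0 => ?_
  obtain ⟨s, t, hst, hne⟩ := (R.gam_eq_zero_iff hA i).1 h0
  rw [smul_projected_add] at hst
  obtain ⟨c, hc⟩ := exists_of_perp_mulVec_eq_zero hst
  have : R.augmented m θ r i *ᵥ (Sum.elim (-c) ![(s : ℂ), (t : ℂ)]) =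
      R.augmented m θ r i *ᵥ 0 := by
    rw [augmented_mulVec, Matrix.mulVec_zero]
    have e : (fun j => Sum.elim (-c) ![(s : ℂ), (t : ℂ)] (Sum.inl j)) = -c := rfl
    rw [e, Matrix.mulVec_neg, ← hc]
    funext k
    simp
  have h1 := h this
  have hs := congrFun h1 (Sum.inr 0)
  have ht := congrFun h1 (Sum.inr 1)
  exact hne ⟨by simpa using hs, by simpa using ht⟩

theorem analyticAt_steer (θ r : ℝ) (k : Fin N) (m : Fin N → ℝ) :
    AnalyticAt ℝ (fun m : Fin N → ℝ => R.steer m θ r k) m := by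
  have h1 : AnalyticAt ℝ (fun m : Fin N → ℝ => ((4 * Real.pi * R.Δf / R.c * m k * r : ℝ) : ℂ)) m :=
    (Complex.ofRealCLM.analyticAt _).comp (f := fun m : Fin N → ℝ =>
      4 * Real.pi * R.Δf / R.c * m k * r)
      ((analyticAt_const.mul ((ContinuousLinearMap.proj k : (Fin N → ℝ) →L[ℝ] ℝ).analyticAt m)).mul
        analyticAt_const)
  have h2 : AnalyticAt ℝ (fun m : Fin N → ℝ =>
      Complex.exp (-Complex.I * ((4 * Real.pi * R.Δf / R.c * m k * r : ℝ) : ℂ))) m :=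
    (analyticAt_cexp.restrictScalars (𝕜 := ℝ)).comp (analyticAt_const.mul h1)
  exact analyticAt_const.mul (analyticAt_const.mul h2)

theorem analyticAt_augmented (θ r : Fin P → ℝ) (i : Fin P) (k : Fin N) (q : Fin P ⊕ Fin 2)
    (m : Fin N → ℝ) : AnalyticAt ℝ (fun m : Fin N → ℝ => R.augmented m θ r i k q) m := by
  rcases q with j | a
  · exact R.analyticAt_steer _ _ k m
  · fin_cases a
    · have h1 : AnalyticAt ℝ (fun m : Fin N → ℝ => ((m k : ℝ) : ℂ)) m :=
        (Complex.ofRealCLM.analyticAt _).comp (f := fun m : Fin N → ℝ => m k)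
          ((ContinuousLinearMap.proj k : (Fin N → ℝ) →L[ℝ] ℝ).analyticAt m)
      exact h1.mul (R.analyticAt_steer _ _ k m)
    · exact analyticAt_const.mul (R.analyticAt_steer _ _ k m)

/-- Gram determinant of the columns of `augmented`. -/
def gramDet (θ r : Fin P → ℝ) (i : Fin P) (m : Fin N → ℝ) : ℂ :=
  ((R.augmented m θ r i)ᴴ * R.augmented m θ r i).det

/-- Conjugation is real linear, so the Leibniz expansion is a polynomial in real-analytic functions
of the code. -/
theorem analyticOnNhd_gramDet (θ r : Fin P → ℝ) (i : Fin P) :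
    AnalyticOnNhd ℝ (R.gramDet θ r i : (Fin N → ℝ) → ℂ) Set.univ := by
  intro m _
  have hconj : ∀ k q, AnalyticAt ℝ (fun m : Fin N → ℝ => star (R.augmented m θ r i k q)) m :=
    fun k q => ((Complex.conjCLE : ℂ →L[ℝ] ℂ).analyticAt _).comp
      (R.analyticAt_augmented θ r i k q m)
  have he : (R.gramDet θ r i : (Fin N → ℝ) → ℂ) = fun m => ∑ s : Equiv.Perm (Fin P ⊕ Fin 2),
      ((Equiv.Perm.sign s : ℤ) : ℂ) * ∏ q, ∑ k, star (R.augmented m θ r i k (s q)) *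
        R.augmented m θ r i k q := by
    funext m
    rw [gramDet, Matrix.det_apply']
    rfl
  rw [he]
  refine Finset.analyticAt_fun_sum _ fun s _ => analyticAt_const.mul ?_
  refine Finset.analyticAt_fun_prod _ fun q _ => Finset.analyticAt_fun_sum _ fun k _ => ?_
  exact (hconj k _).mul (R.analyticAt_augmented θ r i k q m)

theorem augmented_injective_iff (θ r : Fin P → ℝ) (i : Fin P) (m : Fin N → ℝ) :
    Function.Injective (R.augmented m θ r i).mulVec ↔ R.gramDet θ r i m ≠ 0 := by
  constructor
  · exact fun h => (isUnit_det_conjTranspose_mul_self h).ne_zero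
  · intro h x y hxy
    have hinj := Matrix.mulVec_injective_iff_isUnit.2
      ((Matrix.isUnit_iff_isUnit_det _).2 (isUnit_iff_ne_zero.2 h))
    apply hinj
    simp only [← Matrix.mulVec_mulVec]
    exact congrArg _ hxy

theorem exists_augmented_injective {θ r : Fin P → ℝ} (hN : P + 2 ≤ N)
    (hsep : ∀ i j, i ≠ j → r i = r j → ∀ z : ℤ,
      2 * R.fc * R.d * (Real.sin (θ i) - Real.sin (θ j)) / R.c ≠ z) (i : Fin P) :
    ∃ m : Fin N → ℝ, Function.Injective (R.augmented m θ r i).mulVec := by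
  have hc := R.c_pos
  have hΔ := R.Δf_pos
  -- The slope `t` must make the nodes `w j` below distinct. For each pair and integer at most one
  -- `t` is excluded, or none by `hsep` when the ranges agree, so a countable set is avoided.
  obtain ⟨t, ht⟩ : ∃ t : ℝ, ∀ (i j : Fin P) (z : ℤ), i ≠ j →
      2 * R.fc * R.d * (Real.sin (θ i) - Real.sin (θ j)) / R.c +
        2 * R.Δf * t * (r i - r j) / R.c ≠ z := by
    have hcount : (⋃ (i : Fin P) (j : Fin P) (z : ℤ), {t : ℝ | i ≠ j ∧
        2 * R.fc * R.d * (Real.sin (θ i) - Real.sin (θ j)) / R.c +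
          2 * R.Δf * t * (r i - r j) / R.c = z}).Countable := by
      refine Set.countable_iUnion fun i => Set.countable_iUnion fun j =>
        Set.countable_iUnion fun z => Set.Subsingleton.countable ?_
      rintro t ⟨hij, ht⟩ s ⟨-, hs⟩
      by_cases hr : r i = r j
      · exact absurd (by simpa [hr] using ht) (hsep i j hij hr z)
      · have hr' : r i - r j ≠ 0 := sub_ne_zero.2 hr
        have e := ht.trans hs.symm
        rw [add_right_inj] at e
        field_simp at e
        exact e
    obtain ⟨t, ht⟩ := (hcount.dense_compl ℝ).nonempty
    refine ⟨t, fun i j z hij h => ht ?_⟩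
    simp only [Set.mem_iUnion]
    exact ⟨i, j, z, hij, h⟩
  have hlast : N - 1 < N := by omega
  set last : Fin N := ⟨N - 1, hlast⟩ with hl
  -- A linear code makes the steering vectors geometric, but leaves its own column dependent on the
  -- position column. Perturbing the last element breaks this and, as `P + 2 ≤ N`, keeps the `P + 1`
  -- rows needed for the Vandermonde system.
  set m : Fin N → ℝ := fun k => t * pos N k + if k = last then 1 else 0 with hm
  set ph : Fin P → ℝ := fun j => 4 * Real.pi * R.fc * R.d * Real.sin (θ j) / R.c +
    4 * Real.pi * R.Δf / R.c * t * r j with hph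
  set w : Fin P → ℂ := fun j => Complex.exp (-Complex.I * (ph j : ℂ)) with hw
  set a : Fin P → ℂ := fun j => Complex.exp (-Complex.I * ((4 * Real.pi / R.c * R.fc * r j : ℝ) : ℂ)
    + Complex.I * ((ph j * (((N : ℝ) - 1) / 2) : ℝ) : ℂ)) with ha
  have hsteer : ∀ (j : Fin P) (k : Fin N), k ≠ last →
      R.steer m (θ j) (r j) k = a j * w j ^ (k : ℕ) := by
    intro j k hk
    simp only [steer, bD, bR, hm, hk, if_false, add_zero, ha, hw, hph, ← Complex.exp_nat_mul,
      ← Complex.exp_add, pos]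
    congr 1
    push_cast
    ring
  have hwinj : Function.Injective w := by
    intro p q hpq
    by_contra hne
    obtain ⟨z, hz⟩ := Complex.exp_eq_exp_iff_exists_int.1 hpq
    have h1 : ph q - ph p = z * (2 * Real.pi) := by
      have h2 := congrArg Complex.im hz
      simp at h2
      linarith
    apply ht q p z (Ne.symm hne)
    have hpi := Real.pi_pos
    simp only [hph] at h1
    field_simp at h1 ⊢
    linear_combination h1 / 2
  have hane : ∀ j, a j ≠ 0 := fun j => Complex.exp_ne_zero _
  refine ⟨m, ?_⟩
  intro x' y' hxy
  rw [← sub_eq_zero]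
  rw [← sub_eq_zero, ← Matrix.mulVec_sub] at hxy
  set x := x' - y'
  rw [augmented_mulVec] at hxy
  have hrow : ∀ k : Fin N, ∑ j, x (Sum.inl j) * R.steer m (θ j) (r j) k +
      (x (Sum.inr 0) * m k + x (Sum.inr 1) * pos N k) * R.steer m (θ i) (r i) k = 0 := by
    intro k
    have := congrFun hxy k
    rw [matA_mulVec] at this
    simp only [Pi.add_apply, Finset.sum_apply, Pi.smul_apply, smul_eq_mul, weighted,
      Pi.zero_apply] at this
    linear_combination this
  -- On unperturbed rows the two weighted columns enter only through this combination.
  set y : ℂ := x (Sum.inr 0) * t + x (Sum.inr 1) with hy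
  have hV := confluent_vandermonde (w := w) (i := i) hwinj (Complex.exp_ne_zero _)
    -- The correction at `j = i` absorbs the centring shift `(N - 1) / 2` of the positions.
    (v := fun j => x (Sum.inl j) * a j - if j = i then y * a i * (((N : ℂ) - 1) / 2) else 0)
    (y := y * a i) (by
      intro k hk
      have hkN : k < N := by omega
      have hkl : (⟨k, hkN⟩ : Fin N) ≠ last := by
        intro h
        have := congrArg Fin.val h
        simp only [hl] at this
        omega
      have := hrow ⟨k, hkN⟩
      have hmk : m ⟨k, hkN⟩ = t * pos N ⟨k, hkN⟩ := by
        simp only [hm, hkl, if_false, add_zero]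
      simp only [hsteer _ _ hkl, hmk, pos] at this
      simp only [sub_mul, Finset.sum_sub_distrib, ite_mul, zero_mul, Finset.sum_ite_eq',
        Finset.mem_univ, if_true]
      rw [← this]
      have e : ∑ j, x (Sum.inl j) * a j * w j ^ k = ∑ j, x (Sum.inl j) * (a j * w j ^ k) :=
        Finset.sum_congr rfl fun j _ => by ring
      rw [e, hy]
      push_cast
      ring)
  have hy0 : y = 0 := (mul_eq_zero.1 hV.2).resolve_right (hane i)
  have hv0 : ∀ j, x (Sum.inl j) = 0 := by
    intro j
    have := congrFun hV.1 j
    simpa [hy0, hane j] using this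
  have hx0 : x (Sum.inr 0) = 0 := by
    have := hrow last
    simp only [hv0, zero_mul, Finset.sum_const_zero, zero_add, mul_eq_zero,
      R.steer_ne_zero, or_false] at this
    simp only [hm, if_true] at this
    push_cast at this
    -- The last row equals `pos * y` plus the coefficient of the perturbation, and `y = 0`.
    linear_combination this - (pos N last : ℂ) * hy0 + (pos N last : ℂ) * hy
  have hx1 : x (Sum.inr 1) = 0 := by
    rw [hy, hx0, zero_mul, zero_add] at hy0
    exact hy0
  funext q
  rcases q with j | b
  · exact hv0 j
  · fin_cases b
    · exact hx0
    · exact hx1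

theorem ae_random_code {θ r : Fin P → ℝ} (g : Measure ℝ) [IsProbabilityMeasure g]
    (hg : ∀ x : ℝ, g {x} = 0) (hN : P + 2 ≤ N)
    (hsep : ∀ i j, i ≠ j → r i = r j → ∀ z : ℤ,
      2 * R.fc * R.d * (Real.sin (θ i) - Real.sin (θ j)) / R.c ≠ z) :
    ∀ᵐ m ∂(Measure.pi fun _ : Fin N => g),
      LinearIndependent ℂ (fun i => R.steer m (θ i) (r i)) ∧ ∀ i, 0 < R.gam m θ r i := by
  have : NullSingletonClass g := ⟨hg⟩
  have h : ∀ᵐ m ∂(Measure.pi fun _ : Fin N => g), ∀ i, R.gramDet θ r i m ≠ 0 := by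
    rw [ae_all_iff]
    intro i
    obtain ⟨m0, hm0⟩ := R.exists_augmented_injective hN hsep i
    exact (R.analyticOnNhd_gramDet θ r i).ae_pi_ne_zero
      ((R.augmented_injective_iff θ r i m0).1 hm0) g
  filter_upwards [h] with m hm
  have hinj := fun i => (R.augmented_injective_iff θ r i m).2 (hm i)
  refine ⟨?_, fun i => R.gam_pos_of_augmented_injective (hinj i)⟩
  -- Without targets there is no augmented matrix to use.
  rcases isEmpty_or_nonempty (Fin P) with hP | ⟨⟨i⟩⟩
  · exact linearIndependent_empty_type
  · exact R.linearIndependent_of_augmented_injective (hinj i)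

end FDA

end

/-! ### Normalization of the constants and the main theorem -/

noncomputable section

namespace FDA

theorem bound_eq (R : FDA) {s k x γ X C : ℝ} (hx : x ≠ 0) (hs : s ≠ 0) (hk : k ≠ 0)
    (hγ : γ ≠ 0) (hC : C = 2 * k / R.σ ^ 2 * s) :
    X / (C * (x / R.c) ^ 2 * γ) = R.σ ^ 2 * R.c ^ 2 / (2 * k * s * x ^ 2 * γ) * X := by
  have hσ := R.σ_pos
  have hc := R.c_pos
  rw [hC]
  field_simp

end FDA

end

theorem mainTheorem5 (R : FDA) (N P : ℕ) (θ r : Fin P → ℝ) (hθ : ∀ i, Real.cos (θ i) ≠ 0) :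
    -- every frequency code for which the steering vectors are linearly independent
    (∀ m : Fin N → ℝ, LinearIndependent ℂ (fun i => R.steer m (θ i) (r i)) →
      -- the Fisher information matrix for arbitrary amplitudes
      (∀ (L : ℕ) (α : Fin L → Fin P → ℂ),
        R.fimLoc m θ r α = (2 * (L : ℝ) / R.σ ^ 2) •
          (Matrix.hadamard (R.matC m θ r)
            ((FDA.sampleCov α)ᵀ ⊗ₖ (Matrix.of fun _ _ : Fin 2 => (1 : ℂ)))).map Complex.re) ∧
      -- the coefficient `γ`
      (∀ i, 0 ≤ R.gam m θ r i) ∧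
      (∀ i, R.gam m θ r i = 0 ↔
        ¬ LinearIndependent ℝ ![R.projected m θ r m i, R.projected m θ r (FDA.pos N) i]) ∧
      (∀ a e : ℝ, (∀ k, m k = a * FDA.pos N k + e) → ∀ i, R.gam m θ r i = 0) ∧
      (P = 1 → ∀ i, R.gam m θ r i = 0 ↔ ∃ a e : ℝ, ∀ k, m k = a * FDA.pos N k + e) ∧
      -- uncorrelated amplitudes
      (∀ (L : ℕ) (α : Fin L → Fin P → ℂ),
        (∀ i j, i ≠ j → FDA.sampleCov α i j = 0) → (∀ i, FDA.sampleCov α i i ≠ 0) →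
        (∀ i j a b, i ≠ j → R.fimLoc m θ r α (i, a) (j, b) = 0) ∧
        (IsUnit (R.fimLoc m θ r α).det ↔ ∀ i, 0 < R.gam m θ r i) ∧
        ((∀ i, 0 < R.gam m θ r i) →
          (∀ i j a b, (R.fimLoc m θ r α)⁻¹ (i, a) (j, b) =
            if i = j then (FDA.block (R.fimLoc m θ r α) i)⁻¹ a b else 0) ∧
          (∀ q, crb (R.fimLoc m θ r α) q = ENNReal.ofReal ((R.fimLoc m θ r α)⁻¹ q q))) ∧
        (∀ i, 0 < R.gam m θ r i →
          crb (R.fimLoc m θ r α) (i, 0) = ENNReal.ofReal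
            (R.σ ^ 2 * R.c ^ 2 / (2 * L * (FDA.sampleCov α i i).re *
              (4 * Real.pi * R.fc * R.d * Real.cos (θ i)) ^ 2 * R.gam m θ r i) *
              FDA.sqNorm (R.projected m θ r m i)) ∧
          crb (R.fimLoc m θ r α) (i, 1) = ENNReal.ofReal
            (R.σ ^ 2 * R.c ^ 2 / (2 * L * (FDA.sampleCov α i i).re *
              (4 * Real.pi * R.Δf) ^ 2 * R.gam m θ r i) *
              FDA.sqNorm (R.projected m θ r (FDA.pos N) i))) ∧
        (∀ i, R.gam m θ r i = 0 ↔
          crb (R.fimLoc m θ r α) (i, 0) = ⊤ ∨ crb (R.fimLoc m θ r α) (i, 1) = ⊤) ∧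
        (∀ i, R.gam m θ r i = 0 →
          (R.projected m θ r m i ≠ 0 → crb (R.fimLoc m θ r α) (i, 0) = ⊤) ∧
          (R.projected m θ r (FDA.pos N) i ≠ 0 → crb (R.fimLoc m θ r α) (i, 1) = ⊤)) ∧
        -- linear frequency diverse array
        (m = FDA.pos N → ∀ i, R.gam m θ r i = 0 ∧
          crb (R.fimLoc m θ r α) (i, 0) = ⊤ ∧ crb (R.fimLoc m θ r α) (i, 1) = ⊤) ∧
        (∀ a e : ℝ, a ≠ 0 → (∀ k, m k = a * FDA.pos N k + e) → ∀ i,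
          crb (R.fimLoc m θ r α) (i, 0) = ⊤ ∧ crb (R.fimLoc m θ r α) (i, 1) = ⊤)) ∧
      -- amplitudes that are uncorrelated in the limit of many snapshots
      (∀ (α : ℕ → Fin P → ℂ) (s : Fin P → ℝ),
        (∀ i j, i ≠ j → Filter.Tendsto
          (fun L : ℕ => FDA.sampleCov (fun l : Fin L => α l) i j) Filter.atTop (𝓝 0)) →
        (∀ i, Filter.Tendsto
          (fun L : ℕ => (FDA.sampleCov (fun l : Fin L => α l) i i).re) Filter.atTop (𝓝 (s i))) →
        (∀ i, 0 < s i) →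
        (∀ i j a b, i ≠ j → Filter.Tendsto
          (fun L : ℕ => (1 / (L : ℝ)) * R.fimLoc m θ r (fun l : Fin L => α l) (i, a) (j, b))
          Filter.atTop (𝓝 0)) ∧
        ((∀ i, 0 < R.gam m θ r i) → ∀ i,
          Filter.Tendsto
            (fun L : ℕ => (L : ℝ≥0∞) * crb (R.fimLoc m θ r (fun l : Fin L => α l)) (i, 0))
            Filter.atTop (𝓝 (ENNReal.ofReal
              (R.σ ^ 2 * R.c ^ 2 / (2 * s i *
                (4 * Real.pi * R.fc * R.d * Real.cos (θ i)) ^ 2 * R.gam m θ r i) *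
                FDA.sqNorm (R.projected m θ r m i)))) ∧
          Filter.Tendsto
            (fun L : ℕ => (L : ℝ≥0∞) * crb (R.fimLoc m θ r (fun l : Fin L => α l)) (i, 1))
            Filter.atTop (𝓝 (ENNReal.ofReal
              (R.σ ^ 2 * R.c ^ 2 / (2 * s i *
                (4 * Real.pi * R.Δf) ^ 2 * R.gam m θ r i) *
                FDA.sqNorm (R.projected m θ r (FDA.pos N) i))))))) ∧
    -- random frequency code with independent entries of a common law without atoms
    (∀ (g : MeasureTheory.Measure ℝ) [MeasureTheory.IsProbabilityMeasure g],
      (∀ x : ℝ, g {x} = 0) → P + 2 ≤ N →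
      (∀ i j, i ≠ j → r i = r j → ∀ z : ℤ,
        2 * R.fc * R.d * (Real.sin (θ i) - Real.sin (θ j)) / R.c ≠ z) →
      ∀ᵐ m ∂(MeasureTheory.Measure.pi fun _ : Fin N => g),
        LinearIndependent ℂ (fun i => R.steer m (θ i) (r i)) ∧
        (∀ i, 0 < R.gam m θ r i) ∧
        ∀ (L : ℕ) (α : Fin L → Fin P → ℂ),
          (∀ i j, i ≠ j → FDA.sampleCov α i j = 0) → (∀ i, FDA.sampleCov α i i ≠ 0) →
          ∀ q, crb (R.fimLoc m θ r α) q < ⊤) := by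
  have hpa : ∀ i, 4 * Real.pi * R.fc * R.d * Real.cos (θ i) ≠ 0 := by
    intro i
    have h2 := R.fc_pos
    have h3 := R.d_pos
    have h6 := hθ i
    positivity
  have hpb : 4 * Real.pi * R.Δf ≠ 0 := by
    have h4 := R.Δf_pos
    positivity
  refine ⟨fun m h => ⟨fun L α => R.fimLoc_eq h α, R.gam_nonneg h,
    R.gam_eq_zero_iff_not_linearIndependent h, fun a e hm => R.gam_eq_zero_of_linear h hm,
    R.gam_eq_zero_iff_of_single_target h, fun L α h0 h1 => ?_, fun α s h0 h1 hs => ?_⟩,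
    fun g _ hg hN hsep => ?_⟩
  · have hJ := R.isBlockInfo_fimLoc h h0 h1
    have hsym := R.fimLoc_isSymm h α
    have hpos := R.fimLoc_quadratic_nonneg h α
    refine ⟨hJ.off, hJ.isUnit_det h hθ, fun hg => ⟨fun i j a b => ?_, fun q => ?_⟩,
      fun i hi => ?_, hJ.gam_eq_zero_iff_crb_eq_top hsym hpos h hθ,
      fun i hi => hJ.crb_eq_top_of_projected_ne_zero h hθ hi, fun hm i => ?_,
      fun a e ha hm i => hJ.crb_eq_top_of_linear h hθ ha hm i⟩
    · exact FDA.inv_of_blockDiagonal hJ.off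
        (fun i => (hJ.isUnit_det_block h hθ i).2 (hg i)) i j a b
    · exact crb_eq_inv hsym hpos ((hJ.isUnit_det h hθ).2 hg) q
    · obtain ⟨hL, hS⟩ := FDA.sampleCov_pos (h1 i)
      have hLr : (L : ℝ) ≠ 0 := by positivity
      have H := hJ.crb_eq hsym hpos h hθ hi
      rw [H.1, H.2, R.bound_eq (hpa i) hS.ne' hLr hi.ne' rfl,
        R.bound_eq hpb hS.ne' hLr hi.ne' rfl]
      exact ⟨rfl, rfl⟩
    · have hm' : ∀ k, m k = 1 * FDA.pos N k + 0 := fun k => by rw [hm]; ring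
      exact ⟨R.gam_eq_zero_of_linear h hm' i, hJ.crb_eq_top_of_linear h hθ one_ne_zero hm' i⟩
  · set T : Matrix (Fin P) (Fin P) ℂ := Matrix.diagonal fun i => (s i : ℂ) with hT
    have hlim : ∀ i j, Filter.Tendsto
        (fun L : ℕ => FDA.sampleCov (fun l : Fin L => α l) i j) Filter.atTop (𝓝 (T i j)) := by
      intro i j
      by_cases hij : i = j
      · subst hij
        rw [hT, Matrix.diagonal_apply_eq]
        have := (Complex.continuous_ofReal.tendsto _).comp (h1 i)
        -- Diagonal covariances are real, so convergence of their real parts is enough.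
        simpa only [Function.comp_def, FDA.ofReal_re_sampleCov] using this
      · rw [hT, Matrix.diagonal_apply_ne _ hij]
        exact h0 i j hij
    have hJlim := FDA.tendsto_fimLoc (R := R) h hlim
    have hσ := R.σ_pos
    have hJ : R.IsBlockInfo m θ r (fun i => 2 / R.σ ^ 2 * s i)
        ((2 / R.σ ^ 2) • R.infoMat m θ r T) :=
      R.isBlockInfo_smul_infoMat h (fun i => mul_pos (by positivity) (hs i))
        (fun i j hij => Matrix.diagonal_apply_ne _ hij) fun i => Matrix.diagonal_apply_eq _ i
    refine ⟨fun i j a b hij => ?_, fun hg i => ?_⟩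
    · have := hJlim (i, a) (j, b)
      rwa [hJ.off i j a b hij] at this
    · have hdet := (hJ.isUnit_det h hθ).2 hg
      obtain ⟨⟨w, hw, hw'⟩, ⟨v, hv, hv'⟩⟩ := hJ.exists_mulVec_eq_single h hθ (hg i)
      have H1 := FDA.tendsto_mul_crb (fun L => R.fimLoc_isSymm h fun l : Fin L => α l)
        (fun L => R.fimLoc_quadratic_nonneg h fun l : Fin L => α l) hJlim hdet hw
      have H2 := FDA.tendsto_mul_crb (fun L => R.fimLoc_isSymm h fun l : Fin L => α l)
        (fun L => R.fimLoc_quadratic_nonneg h fun l : Fin L => α l) hJlim hdet hv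
      -- The limit of `J / L` carries no factor `L`, so 1 takes the place of the snapshot count.
      rw [hw', R.bound_eq (k := 1) (hpa i) (hs i).ne' one_ne_zero (hg i).ne'
        (by rw [mul_one]), mul_one] at H1
      rw [hv', R.bound_eq (k := 1) hpb (hs i).ne' one_ne_zero (hg i).ne'
        (by rw [mul_one]), mul_one] at H2
      exact ⟨H1, H2⟩
  · filter_upwards [R.ae_random_code (θ := θ) (r := r) g hg hN hsep] with m hm
    refine ⟨hm.1, hm.2, fun L α h0 h1 q => ?_⟩
    have hJ := R.isBlockInfo_fimLoc hm.1 h0 h1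
    rw [crb_eq_inv (R.fimLoc_isSymm hm.1 α) (R.fimLoc_quadratic_nonneg hm.1 α)
      ((hJ.isUnit_det hm.1 hθ).2 hm.2)]
    exact ENNReal.ofReal_lt_top
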